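/- Let $\mathcal T_d$ be the rooted $d$-regular tree whose vertices are the finite words over $\{1,\dots,d\}$. For a tree automorphism $h$ fixing the first level write $h=(h_1,\dots,h_d)$ for its actions on the $d$ subtrees below the root. On $\mathcal T_2$ let $a$ exchange the two branches at the root and define recursively $$b=(a,c),\quad c=(a,d),\quad d=(1,b),\qquad \tilde b=(a,\tilde c),\quad \tilde c=(1,\tilde d),\quad \tilde d=(1,\tilde b);$$ put $\mathfrak G=\langle a,b,c,d\rangle$ (the Grigorchuk group) and $\tilde{\mathfrak G}=\langle a,\tilde b,\tilde c,\tilde d\rangle$. On $\mathcal T_3$ let $a$ permute the three branches at the root cyclically, define recursively $r=(a,1,r)$, $s=(a,a,s)$, $t=(a,a^{-1},t)$, and put $\Gamma=\langle a,r\rangle$, $\overline\Gamma=\langle a,s\rangle$ and $\overline{\overline\Gamma}=\langle a,t\rangle$ (the Gupta–Sidki group). Let $n\ge 1$, let $G$ be one of these five groups, let $P_n$ be the stabilizer in $G$ of any vertex of level $n$, and let $\rho_{G/P_n}$ be the quasi-regular representation of $G$ on the complex Hilbert space $\ell^2(G/P_n)$. (1) If $G=\mathfrak G$ or $G=\tilde{\mathfrak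 G}$, then $\rho_{G/P_n}$ is the orthogonal direct sum of $n+1$ pairwise non-isomorphic irreducible subrepresentations: one of degree $2^i$ for each $i\in\{1,\dots,n-1\}$, and two of degree $1$. (2) If $G=\Gamma$, $\overline\Gamma$ or $\overline{\overline\Gamma}$, then $\rho_{G/P_n}$ is the orthogonal direct sum of $2n+1$ pairwise non-isomorphic irreducible subrepresentations: two of degree $3^i$ for each $i\in\{1,\dots,n-1\}$, and three of degree $1$. -/

import Mathlib

open scoped ENNReal

/-! ### The rooted tree and its automorphisms -/

/-- The rooted `d`-regular tree: vertices are the finite words over the alphabet `Fin d`, and two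
words are joined by an edge when one is obtained from the other by adding one letter on the right.
The root is the empty word. -/
def rootedTree (d : ℕ) : SimpleGraph (List (Fin d)) where
  Adj u v := ∃ s, v = u ++ [s] ∨ u = v ++ [s]
  symm := ⟨fun _ _ ⟨s, h⟩ => ⟨s, h.symm⟩⟩
  loopless := ⟨fun u ⟨s, h⟩ => by simp at h⟩

/-- The automorphism group of the rooted tree; it acts on the set of words. The root is the only
vertex of degree `d`, so it is fixed by each automorphism. -/
abbrev TreeAut (d : ℕ) := rootedTree d ≃g rootedTree d

/-- A map between words that maps the children of each vertex `u` to children of the image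
of `u`. -/
def MapsChildren {d : ℕ} (f : List (Fin d) → List (Fin d)) : Prop :=
  ∀ u s, ∃ s', f (u ++ [s]) = f u ++ [s']

theorem MapsChildren.adj {d : ℕ} {f : List (Fin d) → List (Fin d)} (hf : MapsChildren f)
    {u v : List (Fin d)} (h : (rootedTree d).Adj u v) : (rootedTree d).Adj (f u) (f v) := by
  obtain ⟨s, rfl | rfl⟩ := h
  · obtain ⟨s', h⟩ := hf u s
    exact ⟨s', Or.inl h⟩
  · obtain ⟨s', h⟩ := hf v s
    exact ⟨s', Or.inr h⟩

/-- The tree automorphism with underlying map `f` and inverse map `g`. -/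
def TreeAut.ofMaps {d : ℕ} (f g : List (Fin d) → List (Fin d))
    (hf : MapsChildren f) (hg : MapsChildren g)
    (hgf : ∀ w, g (f w) = w) (hfg : ∀ w, f (g w) = w) : TreeAut d where
  toFun := f
  invFun := g
  left_inv := hgf
  right_inv := hfg
  map_rel_iff' {u v} := by
    refine ⟨fun h => ?_, fun h => hf.adj h⟩
    have h' := hg.adj h
    simpa [hgf] using h'

/-! ### Binary tree: the groups `𝔊` and `𝔊̃`

The letter `0` is the left branch, the letter `1` the right branch. -/

/-- `a`: exchanges the two branches at the root. -/
def swapMap : List (Fin 2) → List (Fin 2)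
  | [] => []
  | x :: w => (x + 1) :: w

mutual
/-- `b = (a, c)`. -/
def bMap : List (Fin 2) → List (Fin 2)
  | [] => []
  | 0 :: w => 0 :: swapMap w
  | 1 :: w => 1 :: cMap w
/-- `c = (a, d)`. -/
def cMap : List (Fin 2) → List (Fin 2)
  | [] => []
  | 0 :: w => 0 :: swapMap w
  | 1 :: w => 1 :: dMap w
/-- `d = (1, b)`. -/
def dMap : List (Fin 2) → List (Fin 2)
  | [] => []
  | 0 :: w => 0 :: w
  | 1 :: w => 1 :: bMap w
end

mutual
/-- `b̃ = (a, c̃)`. -/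
def bTildeMap : List (Fin 2) → List (Fin 2)
  | [] => []
  | 0 :: w => 0 :: swapMap w
  | 1 :: w => 1 :: cTildeMap w
/-- `c̃ = (1, d̃)`. -/
def cTildeMap : List (Fin 2) → List (Fin 2)
  | [] => []
  | 0 :: w => 0 :: w
  | 1 :: w => 1 :: dTildeMap w
/-- `d̃ = (1, b̃)`. -/
def dTildeMap : List (Fin 2) → List (Fin 2)
  | [] => []
  | 0 :: w => 0 :: w
  | 1 :: w => 1 :: bTildeMap w
end

theorem swapMap_swapMap : ∀ w, swapMap (swapMap w) = w
  | [] => rfl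
  | x :: w => by
    have : x + 1 + 1 = x := by revert x; decide
    simp [swapMap, this]

theorem swapMap_mapsChildren : MapsChildren swapMap
  | [], s => ⟨s + 1, rfl⟩
  | _ :: _, s => ⟨s, rfl⟩

theorem bcdMap_involutive (w : List (Fin 2)) :
    bMap (bMap w) = w ∧ cMap (cMap w) = w ∧ dMap (dMap w) = w := by
  induction w with
  | nil => simp [bMap, cMap, dMap]
  | cons x w ih =>
    obtain ⟨hb, hc, hd⟩ := ih
    fin_cases x <;> simp [bMap, cMap, dMap, swapMap_swapMap, hb, hc, hd]

theorem bcdMap_child (u : List (Fin 2)) (s : Fin 2) :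
    (∃ s', bMap (u ++ [s]) = bMap u ++ [s']) ∧ (∃ s', cMap (u ++ [s]) = cMap u ++ [s']) ∧
      (∃ s', dMap (u ++ [s]) = dMap u ++ [s']) := by
  induction u with
  | nil => fin_cases s <;> simp [bMap, cMap, dMap, swapMap]
  | cons x w ih =>
    have ha := swapMap_mapsChildren w s
    fin_cases x <;> simp [bMap, cMap, dMap, ih, ha]

theorem bcdTildeMap_involutive (w : List (Fin 2)) :
    bTildeMap (bTildeMap w) = w ∧ cTildeMap (cTildeMap w) = w ∧
      dTildeMap (dTildeMap w) = w := by
  induction w with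
  | nil => simp [bTildeMap, cTildeMap, dTildeMap]
  | cons x w ih =>
    obtain ⟨hb, hc, hd⟩ := ih
    fin_cases x <;> simp [bTildeMap, cTildeMap, dTildeMap, swapMap_swapMap, hb, hc, hd]

theorem bcdTildeMap_child (u : List (Fin 2)) (s : Fin 2) :
    (∃ s', bTildeMap (u ++ [s]) = bTildeMap u ++ [s']) ∧
      (∃ s', cTildeMap (u ++ [s]) = cTildeMap u ++ [s']) ∧
      (∃ s', dTildeMap (u ++ [s]) = dTildeMap u ++ [s']) := by
  induction u with
  | nil => fin_cases s <;> simp [bTildeMap, cTildeMap, dTildeMap, swapMap]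
  | cons x w ih =>
    have ha := swapMap_mapsChildren w s
    fin_cases x <;> simp [bTildeMap, cTildeMap, dTildeMap, ih, ha]

/-- A tree automorphism from an involutive map. -/
def TreeAut.ofInvolution {d : ℕ} (f : List (Fin d) → List (Fin d)) (hf : MapsChildren f)
    (h : ∀ w, f (f w) = w) : TreeAut d :=
  TreeAut.ofMaps f f hf hf h h

def swapAut : TreeAut 2 := .ofInvolution swapMap swapMap_mapsChildren swapMap_swapMap

def bAut : TreeAut 2 :=
  .ofInvolution bMap (fun u s => (bcdMap_child u s).1) fun w => (bcdMap_involutive w).1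

def cAut : TreeAut 2 :=
  .ofInvolution cMap (fun u s => (bcdMap_child u s).2.1) fun w => (bcdMap_involutive w).2.1

def dAut : TreeAut 2 :=
  .ofInvolution dMap (fun u s => (bcdMap_child u s).2.2) fun w => (bcdMap_involutive w).2.2

def bTildeAut : TreeAut 2 :=
  .ofInvolution bTildeMap (fun u s => (bcdTildeMap_child u s).1)
    fun w => (bcdTildeMap_involutive w).1

def cTildeAut : TreeAut 2 :=
  .ofInvolution cTildeMap (fun u s => (bcdTildeMap_child u s).2.1)
    fun w => (bcdTildeMap_involutive w).2.1

def dTildeAut : TreeAut 2 :=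
  .ofInvolution dTildeMap (fun u s => (bcdTildeMap_child u s).2.2)
    fun w => (bcdTildeMap_involutive w).2.2

/-- The Grigorchuk group `𝔊 = ⟨a, b, c, d⟩`. -/
def grigorchukGroup : Subgroup (TreeAut 2) :=
  Subgroup.closure {swapAut, bAut, cAut, dAut}

/-- The group `𝔊̃ = ⟨a, b̃, c̃, d̃⟩`. -/
def grigorchukTildeGroup : Subgroup (TreeAut 2) :=
  Subgroup.closure {swapAut, bTildeAut, cTildeAut, dTildeAut}

/-! ### Ternary tree: the groups `Γ`, `Γ̄` and the Gupta–Sidki group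

The letters `0`, `1`, `2` are the first, second and third branch. -/

/-- `a ^ k`, where `a` permutes the three branches at the root cyclically. -/
def rotMap (k : Fin 3) : List (Fin 3) → List (Fin 3)
  | [] => []
  | x :: w => (x + k) :: w

/-- The map `g` with `g = (a ^ k, a ^ l, g)`. -/
def spineMap (k l : Fin 3) : List (Fin 3) → List (Fin 3)
  | [] => []
  | 0 :: w => 0 :: rotMap k w
  | 1 :: w => 1 :: rotMap l w
  | 2 :: w => 2 :: spineMap k l w

theorem rotMap_neg (k : Fin 3) : ∀ w, rotMap (-k) (rotMap k w) = w
  | [] => rfl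
  | x :: w => by simp [rotMap]

theorem rotMap_neg' (k : Fin 3) : ∀ w, rotMap k (rotMap (-k) w) = w
  | [] => rfl
  | x :: w => by simp [rotMap]

theorem rotMap_mapsChildren (k : Fin 3) : MapsChildren (rotMap k)
  | [], s => ⟨s + k, rfl⟩
  | _ :: _, s => ⟨s, rfl⟩

theorem spineMap_neg (k l : Fin 3) (w : List (Fin 3)) :
    spineMap (-k) (-l) (spineMap k l w) = w := by
  induction w with
  | nil => rfl
  | cons x w ih => fin_cases x <;> simp [spineMap, rotMap_neg, ih]

theorem spineMap_neg' (k l : Fin 3) (w : List (Fin 3)) :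
    spineMap k l (spineMap (-k) (-l) w) = w := by
  induction w with
  | nil => rfl
  | cons x w ih => fin_cases x <;> simp [spineMap, rotMap_neg', ih]

theorem spineMap_mapsChildren (k l : Fin 3) : MapsChildren (spineMap k l) := by
  intro u s
  induction u with
  | nil => fin_cases s <;> simp [spineMap, rotMap]
  | cons x w ih =>
    have hk := rotMap_mapsChildren k w s
    have hl := rotMap_mapsChildren l w s
    fin_cases x <;> simp [spineMap, ih, hk, hl]

/-- `a`: the cyclic permutation of the three branches at the root. -/
def rotAut : TreeAut 3 :=
  .ofMaps (rotMap 1) (rotMap (-1)) (rotMap_mapsChildren _) (rotMap_mapsChildren _)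
    (rotMap_neg 1) (rotMap_neg' 1)

/-- The automorphism `g` with `g = (a ^ k, a ^ l, g)`. -/
def spineAut (k l : Fin 3) : TreeAut 3 :=
  .ofMaps (spineMap k l) (spineMap (-k) (-l)) (spineMap_mapsChildren _ _)
    (spineMap_mapsChildren _ _) (spineMap_neg k l) (spineMap_neg' k l)

/-- `Γ = ⟨a, r⟩` with `r = (a, 1, r)`. -/
def gammaGroup : Subgroup (TreeAut 3) :=
  Subgroup.closure {rotAut, spineAut 1 0}

/-- `Γ̄ = ⟨a, s⟩` with `s = (a, a, s)`. -/
def gammaBarGroup : Subgroup (TreeAut 3) :=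
  Subgroup.closure {rotAut, spineAut 1 1}

/-- The Gupta–Sidki group `⟨a, t⟩` with `t = (a, a⁻¹, t)`. -/
def guptaSidkiGroup : Subgroup (TreeAut 3) :=
  Subgroup.closure {rotAut, spineAut 1 (-1)}

/-! ### Quasi-regular representations -/

/-- The quasi-regular representation `ρ_{G/H}` of `G` on `ℓ²(G/H)`, by left translation:
`(ρ(g) f)(x) = f(g⁻¹ x)`. -/
noncomputable def quasiRegular {G : Type*} [Group G] (H : Subgroup G) :
    Representation ℂ G (lp (fun _ : G ⧸ H => ℂ) 2) where
  toFun g :=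
    { toFun := fun f => ⟨fun x => f (g⁻¹ • x), by
        have hf := (memℓp_gen_iff (by norm_num)).1 (lp.memℓp f)
        exact memℓp_gen ((MulAction.toPerm g⁻¹ : Equiv.Perm (G ⧸ H)).summable_iff.2 hf)⟩
      map_add' := fun _ _ => rfl
      map_smul' := fun _ _ => rfl }
  map_one' := by
    ext f x
    simp
  map_mul' g h := by
    ext f x
    simp only [mul_inv_rev, mul_smul]
    rfl

/-- The representation `ρ` is the orthogonal direct sum of `m` irreducible subrepresentations,
pairwise non-isomorphic, whose degrees form the multiset `degrees`. -/
def SplitsIntoDistinctIrreducibles {G V : Type*} [Group G] [NormedAddCommGroup V]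
    [InnerProductSpace ℂ V] (ρ : Representation ℂ G V) (m : ℕ) (degrees : Multiset ℕ) : Prop :=
  ∃ W : Fin m → Subrepresentation ρ,
    DirectSum.IsInternal (fun i => (W i).toSubmodule) ∧
    (Pairwise fun i j => (W i).toSubmodule ⟂ (W j).toSubmodule) ∧
    (∀ i, (W i).toRepresentation.IsIrreducible) ∧
    (Pairwise fun i j =>
      IsEmpty (Representation.Equiv (W i).toRepresentation (W j).toRepresentation)) ∧
    (Finset.univ : Finset (Fin m)).val.map
      (fun i => Module.finrank ℂ (W i).toSubmodule) = degrees

/-!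
Number the letters of a word from `0`. Every element of the five groups rotates the children of each
vertex cyclically. Hence, for `m < n` and a character `χ` of `ℤ/d`, the functions on the level `n`
that depend only on the first `m + 1` letters, and on the letter in position `m` through the factor
`χ`, form an invariant subspace of dimension `d ^ m` (`charComponent`, `finrank_charComponent`).
Taking every `χ` for `m = 0` and the nontrivial `χ` for `m ≥ 1` gives pairwise orthogonal subspaces
whose dimensions add up to `d ^ n`, so the point is that they are irreducible and not isomorphic.

Both follow from one property of the group (`SelfReplicating.exists_fix_and_rotatesAt`): if `v` has
length `|w| + 1` and `w` is not a prefix of `v`, then some element fixes `v` and `w` and rotates the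
children of `w` nontrivially. Averaging a nonzero function of an invariant subspace over the
stabilizer of a vertex `v` of level `m + 1` gives a function fixed by this stabilizer. As a
nontrivial `χ` is not `1` at nonzero rotations, such a function vanishes below each vertex of level
`m` that is not a prefix of `v` (`eq_zero_of_fixed`). Its translates therefore span the whole
component (`charComponent_isIrreducible`). An isomorphism between two components of the same degree
preserves the line of these fixed functions, on which the stabilizer of the prefix of length `m`
acts through `χ`, so it determines `χ` (`isEmpty_equiv_charComponent`).

The separation property is a weak form of branching. When `v` and `w` start with the same letter,
self-replication reduces it to shorter words. When they start with letters `x ≠ y`, one uses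
elements of the group that are trivial below `x`. Their actions below `y` contain the normal closure
of an element `κ`, namely `b` for the binary groups, because `d = (1, b)`, and `[a, g]` for the
ternary group generated by `a` and `g = (a, a ^ l, g)`, because commutators of conjugates of `g`
have trivial sections where both entries are powers of `a`. Sections of the normal closure of `κ`
contain an element `μ`, namely `c a` and `g a⁻¹`, that moves the letters on the first level and
recurs among the sections of its own normal closure. The latter therefore has elements fixing any
given vertex and rotating its children.
-/


/-! ### Automorphisms rotating the children of each vertex -/

section Cyclic

variable {d : ℕ} [NeZero d]

/-- The automorphisms that fix the root and map the children of each vertex to the children of its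
image by a cyclic rotation of the alphabet. -/
def cyclicAut (d : ℕ) [NeZero d] : Subgroup (TreeAut d) where
  carrier := {g | g [] = [] ∧ ∀ u, ∃ k : Fin d, ∀ s, g (u ++ [s]) = g u ++ [s + k]}
  one_mem' := ⟨rfl, fun u => ⟨0, fun s => by simp⟩⟩
  mul_mem' := by
    rintro g h ⟨hg, hg'⟩ ⟨hh, hh'⟩
    refine ⟨by simp [hg, hh], fun u => ?_⟩
    obtain ⟨k, hk⟩ := hh' u
    obtain ⟨l, hl⟩ := hg' (h u)
    exact ⟨k + l, fun s => by simp [hk, hl, add_assoc]⟩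
  inv_mem' := by
    rintro g ⟨hg, hg'⟩
    refine ⟨by conv_lhs => rw [← hg, RelIso.inv_apply_self], fun u => ?_⟩
    obtain ⟨k, hk⟩ := hg' (g⁻¹ u)
    refine ⟨-k, fun s => ?_⟩
    have h := hk (s + -k)
    rw [neg_add_cancel_right, RelIso.apply_inv_self] at h
    rw [← h, RelIso.inv_apply_self]

theorem cyclicAut.length_apply {g : TreeAut d} (hg : g ∈ cyclicAut d) (u : List (Fin d)) :
    (g u).length = u.length := by
  induction u using List.reverseRecOn with
  | nil => simp [hg.1]
  | append_singleton u s ih =>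
    obtain ⟨k, hk⟩ := hg.2 u
    simp [hk, ih]

theorem cyclicAut.take_apply {g : TreeAut d} (hg : g ∈ cyclicAut d) (m : ℕ) (u : List (Fin d)) :
    (g u).take m = g (u.take m) := by
  induction u using List.reverseRecOn with
  | nil => simp [hg.1]
  | append_singleton u s ih =>
    obtain ⟨k, hk⟩ := hg.2 u
    rcases le_or_gt m u.length with h | h
    · rw [hk, List.take_append_of_le_length h,
        List.take_append_of_le_length (by rwa [length_apply hg]), ih]
    · rw [List.take_of_length_le, List.take_of_length_le]
      · simpa using h
      · simpa [length_apply hg] using h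

/-- `g` fixes the vertex `w` and rotates its children by a nonzero amount. -/
def RotatesAt (g : TreeAut d) (w : List (Fin d)) : Prop :=
  g w = w ∧ ∃ k : Fin d, k ≠ 0 ∧ ∀ s, g (w ++ [s]) = w ++ [s + k]

end Cyclic

/-! ### Sections and rigid elements -/

section Sections

variable {d : ℕ}

/-- The automorphisms by which elements of `N` fixing the letter `y` act on the subtree
below `y`. -/
def sectionSubgroup (y : Fin d) (N : Subgroup (TreeAut d)) : Subgroup (TreeAut d) where
  carrier := {h | ∃ n ∈ N, ∀ w, n (y :: w) = y :: h w}
  one_mem' := ⟨1, N.one_mem, fun _ => rfl⟩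
  mul_mem' := by
    rintro h h' ⟨n, hn, e⟩ ⟨n', hn', e'⟩
    exact ⟨n * n', N.mul_mem hn hn', fun w => by simp [e, e']⟩
  inv_mem' := by
    rintro h ⟨n, hn, e⟩
    refine ⟨n⁻¹, N.inv_mem hn, fun w => ?_⟩
    rw [← RelIso.inv_apply_self n (y :: h⁻¹ w), e, RelIso.apply_inv_self]

theorem sectionSubgroup_mono (y : Fin d) {N N' : Subgroup (TreeAut d)} (h : N ≤ N') :
    sectionSubgroup y N ≤ sectionSubgroup y N' :=
  fun _ ⟨n, hn, e⟩ => ⟨n, h hn, e⟩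

/-- The automorphisms that fix every vertex of the subtree below the letter `x`. -/
def branchFixer (x : Fin d) : Subgroup (TreeAut d) where
  carrier := {g | ∀ u, g (x :: u) = x :: u}
  one_mem' := fun _ => rfl
  mul_mem' := fun {g h} hg hh u => by
    rw [RelIso.mul_apply, hh, hg]
  inv_mem' := fun {g} hg u => by
    conv_lhs => rw [← hg u]
    simp

/-- The actions on the subtree below `y` of the elements of `G` that fix the subtree below `x`. -/
def ristSection (G : Subgroup (TreeAut d)) (x y : Fin d) : Subgroup (TreeAut d) :=
  sectionSubgroup y (G ⊓ branchFixer x)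

/-- `N` is stable under conjugation by the elements of `G`. -/
def NormalizedBy (G N : Subgroup (TreeAut d)) : Prop :=
  ∀ g ∈ G, ∀ n ∈ N, g * n * g⁻¹ ∈ N

theorem normalizedBy_self (G : Subgroup (TreeAut d)) : NormalizedBy G G :=
  fun _ hg _ hn => G.mul_mem (G.mul_mem hg hn) (G.inv_mem hg)

/-- The smallest subgroup that contains `z` and is stable under conjugation by `G`. -/
def conjClosure (G : Subgroup (TreeAut d)) (z : TreeAut d) : Subgroup (TreeAut d) :=
  Subgroup.closure {h | ∃ g ∈ G, h = g * z * g⁻¹}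

theorem self_mem_conjClosure (G : Subgroup (TreeAut d)) (z : TreeAut d) : z ∈ conjClosure G z :=
  Subgroup.subset_closure ⟨1, G.one_mem, by simp⟩

theorem conjClosure_le {G N : Subgroup (TreeAut d)} {z : TreeAut d} (hN : NormalizedBy G N)
    (hz : z ∈ N) : conjClosure G z ≤ N := by
  rw [conjClosure, Subgroup.closure_le]
  rintro _ ⟨g, hg, rfl⟩
  exact hN g hg z hz

theorem normalizedBy_conjClosure (G : Subgroup (TreeAut d)) (z : TreeAut d) :
    NormalizedBy G (conjClosure G z) := by
  intro g hg n hn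
  induction hn using Subgroup.closure_induction with
  | mem x hx =>
    obtain ⟨h, hh, rfl⟩ := hx
    exact Subgroup.subset_closure ⟨g * h, G.mul_mem hg hh, by group⟩
  | one => simp
  | mul x y _ _ hx hy => simpa [mul_assoc] using (conjClosure G z).mul_mem hx hy
  | inv x _ hx => simpa [mul_assoc] using (conjClosure G z).inv_mem hx

theorem NormalizedBy.commutator_mem {G N : Subgroup (TreeAut d)} (h : NormalizedBy G N)
    {n g : TreeAut d} (hn : n ∈ N) (hg : g ∈ G) : n * g * n⁻¹ * g⁻¹ ∈ N := by
  have := N.mul_mem hn (h g hg _ (N.inv_mem hn))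
  simpa [mul_assoc] using this

end Sections

/-! ### Self-replicating groups -/

section SelfReplicating

variable {d : ℕ} [NeZero d]

/-- A group of automorphisms with cyclic local action that contains the rotations of the first
level and in which each element is the action, below any chosen letter, of some element
of the group. -/
structure SelfReplicating (G : Subgroup (TreeAut d)) : Prop where
  cyclic : G ≤ cyclicAut d
  rotate : ∀ k : Fin d, ∃ r ∈ G, ∀ x u, r (x :: u) = (x + k) :: u
  lift : ∀ y, G ≤ sectionSubgroup y G

namespace SelfReplicating

variable {G : Subgroup (TreeAut d)} (hG : SelfReplicating G)
include hG

theorem exists_move (x y : Fin d) : ∃ r ∈ G, ∀ u, r (x :: u) = y :: u := by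
  obtain ⟨r, hr, h⟩ := hG.rotate (y - x)
  exact ⟨r, hr, fun u => by simp [h]⟩

theorem exists_apply_eq (v w : List (Fin d)) (h : v.length = w.length) : ∃ g ∈ G, g v = w := by
  induction v generalizing w with
  | nil => exact ⟨1, G.one_mem, by simpa using (List.length_eq_zero_iff.1 h.symm).symm⟩
  | cons x v ih =>
    obtain _ | ⟨y, w⟩ := w
    · simp at h
    obtain ⟨g, hg, e⟩ := ih w (by simpa using h)
    obtain ⟨g', hg', e'⟩ := hG.lift x hg
    obtain ⟨r, hr, hr'⟩ := hG.exists_move x y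
    exact ⟨r * g', G.mul_mem hr hg', by simp [e', e, hr']⟩

theorem sectionSubgroup_le {N : Subgroup (TreeAut d)} (hN : NormalizedBy G N) (x y : Fin d) :
    sectionSubgroup x N ≤ sectionSubgroup y N := by
  rintro h ⟨n, hn, e⟩
  obtain ⟨r, hr, e'⟩ := hG.exists_move x y
  refine ⟨r * n * r⁻¹, hN r hr n hn, fun w => ?_⟩
  have : r⁻¹ (y :: w) = x :: w := by rw [← e', RelIso.inv_apply_self]
  simp [this, e, e']

theorem normalizedBy_sectionSubgroup {N : Subgroup (TreeAut d)} (hN : NormalizedBy G N)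
    (y : Fin d) : NormalizedBy G (sectionSubgroup y N) := by
  rintro g hg n ⟨n', hn', e⟩
  obtain ⟨g', hg', e'⟩ := hG.lift y hg
  refine ⟨g' * n' * g'⁻¹, hN g' hg' n' hn', fun w => ?_⟩
  have : g'⁻¹ (y :: w) = y :: g⁻¹ w := by
    rw [← RelIso.inv_apply_self g' (y :: g⁻¹ w), e', RelIso.apply_inv_self]
  simp [this, e, e']

/-- An element that maps the subtree below one letter to itself maps the subtree below each letter
to itself, since the action on the first level is a rotation. -/
theorem exists_apply_cons {g : TreeAut d} (hg : g ∈ G) {y : Fin d} (hy : g [y] = [y])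
    (x : Fin d) (u : List (Fin d)) : ∃ u', g (x :: u) = x :: u' := by
  obtain ⟨h0, h⟩ := hG.cyclic hg
  obtain ⟨k, hk⟩ := h []
  have hk0 : k = 0 := by
    have := hk y
    simpa [h0, hy] using this
  have hx : g [x] = [x] := by simpa [h0, hk0] using hk x
  have ht := cyclicAut.take_apply (hG.cyclic hg) 1 (x :: u)
  have hl := cyclicAut.length_apply (hG.cyclic hg) (x :: u)
  rcases hgu : g (x :: u) with _ | ⟨z, u'⟩
  · simp [hgu] at hl
  · simp only [hgu, List.take_succ_cons, List.take_zero, hx] at ht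
    obtain rfl : z = x := by simpa using ht
    exact ⟨u', rfl⟩

theorem normalizedBy_ristSection (x y : Fin d) : NormalizedBy G (ristSection G x y) := by
  rintro g hg n ⟨n', ⟨hn', hx⟩, e⟩
  obtain ⟨g', hg', e'⟩ := hG.lift y hg
  have hinv : ∀ w, g'⁻¹ (y :: w) = y :: g⁻¹ w := fun w => by
    rw [← RelIso.inv_apply_self g' (y :: g⁻¹ w), e', RelIso.apply_inv_self]
  have hy : g'⁻¹ [y] = [y] := by
    rw [hinv, (hG.cyclic (G.inv_mem hg)).1]
  refine ⟨g' * n' * g'⁻¹, ⟨normalizedBy_self G g' hg' n' hn', fun u => ?_⟩, fun w => ?_⟩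
  · obtain ⟨u', hu'⟩ := hG.exists_apply_cons (G.inv_mem hg') hy x u
    rw [RelIso.mul_apply, RelIso.mul_apply, hu', hx, ← hu', RelIso.apply_inv_self]
  · simp [hinv, e, e']

theorem ristSection_le_add (x y k : Fin d) :
    ristSection G x y ≤ ristSection G (x + k) (y + k) := by
  rintro h ⟨n, ⟨hn, hx⟩, e⟩
  obtain ⟨r, hr, hr'⟩ := hG.rotate k
  have hinv : ∀ z u, r⁻¹ ((z + k) :: u) = z :: u := fun z u => by
    rw [← hr', RelIso.inv_apply_self]
  refine ⟨r * n * r⁻¹, ⟨normalizedBy_self G r hr n hn, fun u => ?_⟩, fun w => ?_⟩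
  · simp [hinv, hx u, hr']
  · simp [hinv, e, hr']

/-- If `z` moves the children of the root and is again a section of an element of the normal
closure of `z`, then this normal closure has an element fixing any given vertex and rotating
its children. -/
theorem exists_rotatesAt_of_mem_sectionSubgroup {z : TreeAut d} (hz : RotatesAt z [])
    {y₀ : Fin d} (h : z ∈ sectionSubgroup y₀ (conjClosure G z)) (w : List (Fin d)) :
    ∃ g ∈ conjClosure G z, RotatesAt g w := by
  have hN := normalizedBy_conjClosure G z
  induction w with
  | nil => exact ⟨z, self_mem_conjClosure G z, hz⟩
  | cons y w ih =>
    obtain ⟨g, hg, hw, k, hk, e⟩ := ih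
    obtain ⟨g', hg', e'⟩ := conjClosure_le (hG.normalizedBy_sectionSubgroup hN y)
      (hG.sectionSubgroup_le hN y₀ y h) hg
    exact ⟨g', hg', by simp [e', hw], k, hk, fun s => by simp [e', e]⟩

/-- If `w` is not a prefix of `v`, the stabilizer of `v` has an element that fixes `w` and rotates
the children of `w`. Elements moving only vertices outside the branch of `v` are supplied by
`κ`; the normal closure of `κ` has `μ` as a section, and the normal closure of `μ` reaches every
vertex. -/
theorem exists_fix_and_rotatesAt
    (base : ∀ x y : Fin d, x ≠ y → ∃ g ∈ G, RotatesAt g [y] ∧ ∀ s, g [x, s] = [x, s])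
    {κ μ : TreeAut d} (hκ : ∀ x y : Fin d, x ≠ y → κ ∈ ristSection G x y)
    {y₀ y₁ : Fin d} (hμκ : μ ∈ sectionSubgroup y₀ (conjClosure G κ))
    (hμ : RotatesAt μ []) (hμμ : μ ∈ sectionSubgroup y₁ (conjClosure G μ))
    (v w : List (Fin d)) (hvw : v.length = w.length + 1) (hne : v.take w.length ≠ w) :
    ∃ g ∈ G, g v = v ∧ RotatesAt g w := by
  induction w generalizing v with
  | nil => simp at hne
  | cons y w ih =>
    obtain _ | ⟨x, v⟩ := v
    · simp at hvw
    have hl : v.length = w.length + 1 := by simpa using hvw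
    by_cases hxy : x = y
    · subst hxy
      obtain ⟨g, hg, hv, hw, k, hk, e⟩ := ih v hl (by simpa using hne)
      obtain ⟨g', hg', e'⟩ := hG.lift x hg
      exact ⟨g', hg', by simp [e', hv], by simp [e', hw], k, hk, fun s => by simp [e', e]⟩
    obtain _ | ⟨z, w⟩ := w
    · obtain ⟨s, rfl⟩ := List.length_eq_one_iff.1 hl
      obtain ⟨g, hg, h, h'⟩ := base x y hxy
      exact ⟨g, hg, h' s, h⟩
    · have hN := normalizedBy_conjClosure G κ
      have hle : conjClosure G μ ≤ sectionSubgroup z (ristSection G x y) :=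
        (conjClosure_le (hG.normalizedBy_sectionSubgroup hN z)
          (hG.sectionSubgroup_le hN y₀ z hμκ)).trans
          (sectionSubgroup_mono z (conjClosure_le (hG.normalizedBy_ristSection x y) (hκ x y hxy)))
      obtain ⟨g, hg, hw, k, hk, e⟩ := hG.exists_rotatesAt_of_mem_sectionSubgroup hμ hμμ w
      obtain ⟨g₁, ⟨g₂, ⟨hg₂, hx⟩, e₂⟩, e₁⟩ := hle hg
      exact ⟨g₂, hg₂, hx v, by simp [e₂, e₁, hw], k, hk, fun s => by simp [e₂, e₁, e]⟩

end SelfReplicating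

end SelfReplicating

/-! ### The binary groups -/

section Binary

@[simp] theorem swapAut_nil : swapAut [] = [] := rfl
@[simp] theorem swapAut_cons (x : Fin 2) (w : List (Fin 2)) : swapAut (x :: w) = (x + 1) :: w := rfl

theorem swapAut_inv : swapAut⁻¹ = swapAut := rfl

theorem swapAut_mem_cyclicAut : swapAut ∈ cyclicAut 2 := by
  refine ⟨rfl, fun u => ?_⟩
  cases u with
  | nil => exact ⟨1, fun s => rfl⟩
  | cons x u => exact ⟨0, fun s => by simp⟩

/-- The recursive definitions of `b`, `c`, `d`, for both binary groups at once: the section of `c`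
at the left letter, `c₀`, is `a` or trivial. -/
structure IsBinarySystem (b c d c₀ : TreeAut 2) : Prop where
  c_eq : c₀ = swapAut ∨ c₀ = 1
  b_nil : b [] = []
  b_zero : ∀ w, b (0 :: w) = 0 :: swapAut w
  b_one : ∀ w, b (1 :: w) = 1 :: c w
  c_nil : c [] = []
  c_zero : ∀ w, c (0 :: w) = 0 :: c₀ w
  c_one : ∀ w, c (1 :: w) = 1 :: d w
  d_nil : d [] = []
  d_zero : ∀ w, d (0 :: w) = 0 :: w
  d_one : ∀ w, d (1 :: w) = 1 :: b w
  b_sq : b * b = 1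
  c_sq : c * c = 1
  d_sq : d * d = 1

theorem isBinarySystem : IsBinarySystem bAut cAut dAut swapAut where
  c_eq := .inl rfl
  b_nil := rfl
  b_zero _ := rfl
  b_one _ := rfl
  c_nil := rfl
  c_zero _ := rfl
  c_one _ := rfl
  d_nil := rfl
  d_zero _ := rfl
  d_one _ := rfl
  b_sq := by ext1 w; exact (bcdMap_involutive w).1
  c_sq := by ext1 w; exact (bcdMap_involutive w).2.1
  d_sq := by ext1 w; exact (bcdMap_involutive w).2.2

theorem isBinarySystem_tilde : IsBinarySystem bTildeAut cTildeAut dTildeAut 1 where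
  c_eq := .inr rfl
  b_nil := rfl
  b_zero _ := rfl
  b_one _ := rfl
  c_nil := rfl
  c_zero _ := rfl
  c_one _ := rfl
  d_nil := rfl
  d_zero _ := rfl
  d_one _ := rfl
  b_sq := by ext1 w; exact (bcdTildeMap_involutive w).1
  c_sq := by ext1 w; exact (bcdTildeMap_involutive w).2.1
  d_sq := by ext1 w; exact (bcdTildeMap_involutive w).2.2

namespace IsBinarySystem

variable {b c d c₀ : TreeAut 2} (h : IsBinarySystem b c d c₀)
include h

theorem mem_cyclicAut : b ∈ cyclicAut 2 ∧ c ∈ cyclicAut 2 ∧ d ∈ cyclicAut 2 := by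
  have h₀ : c₀ ∈ cyclicAut 2 := by
    rcases h.c_eq with h | h <;> rw [h]
    exacts [swapAut_mem_cyclicAut, one_mem _]
  suffices H : ∀ u : List (Fin 2), (∃ k, ∀ s, b (u ++ [s]) = b u ++ [s + k]) ∧
      (∃ k, ∀ s, c (u ++ [s]) = c u ++ [s + k]) ∧ ∃ k, ∀ s, d (u ++ [s]) = d u ++ [s + k] from
    ⟨⟨h.b_nil, fun u => (H u).1⟩, ⟨h.c_nil, fun u => (H u).2.1⟩, ⟨h.d_nil, fun u => (H u).2.2⟩⟩
  intro u
  induction u with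
  | nil =>
    refine ⟨⟨0, fun s => ?_⟩, ⟨0, fun s => ?_⟩, ⟨0, fun s => ?_⟩⟩ <;> fin_cases s <;>
      simp [h.b_nil, h.b_zero, h.b_one, h.c_nil, h.c_zero, h.c_one, h.d_nil, h.d_zero, h.d_one,
        h₀.1]
  | cons x u ih =>
    obtain ⟨⟨k, hk⟩, ⟨l, hl⟩, ⟨m, hm⟩⟩ := ih
    obtain ⟨i, hi⟩ := swapAut_mem_cyclicAut.2 u
    obtain ⟨j, hj⟩ := h₀.2 u
    fin_cases x
    · exact ⟨⟨i, fun s => by simp [h.b_zero, hi]⟩, ⟨j, fun s => by simp [h.c_zero, hj]⟩,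
        ⟨0, fun s => by simp [h.d_zero]⟩⟩
    · exact ⟨⟨l, fun s => by simp [h.b_one, hl]⟩, ⟨m, fun s => by simp [h.c_one, hm]⟩,
        ⟨k, fun s => by simp [h.d_one, hk]⟩⟩

theorem selfReplicating : SelfReplicating (Subgroup.closure {swapAut, b, c, d}) := by
  set G := Subgroup.closure {swapAut, b, c, d} with hG
  have ha : swapAut ∈ G := Subgroup.subset_closure (by simp)
  have hb : b ∈ G := Subgroup.subset_closure (by simp)
  have hc : c ∈ G := Subgroup.subset_closure (by simp)
  have hd : d ∈ G := Subgroup.subset_closure (by simp)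
  refine ⟨?_, fun k => ?_, fun y => ?_⟩
  · rw [hG, Subgroup.closure_le]
    obtain ⟨h₁, h₂, h₃⟩ := h.mem_cyclicAut
    rintro _ (rfl | rfl | rfl | rfl)
    exacts [swapAut_mem_cyclicAut, h₁, h₂, h₃]
  · fin_cases k
    exacts [⟨1, one_mem _, fun x u => by simp⟩, ⟨swapAut, ha, fun x u => rfl⟩]
  · conv_lhs => rw [hG]
    rw [Subgroup.closure_le]
    fin_cases y
    · have key : ∀ {g k : TreeAut 2}, g ∈ G → (∀ w, g (1 :: w) = 1 :: k w) →
          k ∈ sectionSubgroup 0 G := fun {g k} hg e =>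
        ⟨swapAut * g * swapAut, G.mul_mem (G.mul_mem ha hg) ha, fun w => by simp [e]⟩
      rintro _ (rfl | rfl | rfl | rfl)
      exacts [⟨b, hb, h.b_zero⟩, key hd h.d_one, key hb h.b_one, key hc h.c_one]
    · rintro _ (rfl | rfl | rfl | rfl)
      exacts [⟨swapAut * b * swapAut, G.mul_mem (G.mul_mem ha hb) ha, fun w => by simp [h.b_zero]⟩,
        ⟨d, hd, h.d_one⟩, ⟨b, hb, h.b_one⟩, ⟨c, hc, h.c_one⟩]

/-- Here the rigid element `κ` is `b`, coming from `d = (1, b)`, and `μ = c a`, which is the left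
section of `(a b a) b = (c, a) (a, c)`. -/
theorem exists_fix_and_rotatesAt (v w : List (Fin 2)) (hvw : v.length = w.length + 1)
    (hne : v.take w.length ≠ w) :
    ∃ g ∈ Subgroup.closure {swapAut, b, c, d}, g v = v ∧ RotatesAt g w := by
  have hG' := h.selfReplicating
  set G := Subgroup.closure {swapAut, b, c, d} with hG
  have ha : swapAut ∈ G := Subgroup.subset_closure (by simp)
  have hb : b ∈ G := Subgroup.subset_closure (by simp)
  have hc : c ∈ G := Subgroup.subset_closure (by simp)
  have hd : d ∈ G := Subgroup.subset_closure (by simp)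
  have hb' : b⁻¹ = b := inv_eq_of_mul_eq_one_left h.b_sq
  have hc' : c⁻¹ = c := inv_eq_of_mul_eq_one_left h.c_sq
  have ha' : swapAut * swapAut = 1 := by ext1 w; exact swapMap_swapMap w
  have hc1 : ∀ s : Fin 2, c [s] = [s] := fun s => by
    rcases h.c_eq with e | e <;> fin_cases s <;> simp [h.c_zero, h.c_one, e, h.d_nil]
  refine hG'.exists_fix_and_rotatesAt (fun x y hxy => ?_) (κ := b) (μ := c * swapAut)
    (fun x y hxy => ?_) (y₀ := 0) (y₁ := 0) ?_ ?_ ?_ v w hvw hne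
  · obtain ⟨rfl, rfl⟩ | ⟨rfl, rfl⟩ : (x = 1 ∧ y = 0) ∨ (x = 0 ∧ y = 1) := by
      revert x y; decide
    · exact ⟨b, hb, ⟨by simp [h.b_zero], 1, by decide, fun s => by simp [h.b_zero]⟩,
        fun s => by simp [h.b_one, hc1]⟩
    · exact ⟨swapAut * b * swapAut, G.mul_mem (G.mul_mem ha hb) ha,
        ⟨by simp [h.b_zero], 1, by decide, fun s => by simp [h.b_zero]⟩,
        fun s => by simp [h.b_one, hc1]⟩
  · have h01 : b ∈ ristSection G 0 1 := ⟨d, ⟨hd, h.d_zero⟩, h.d_one⟩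
    obtain ⟨rfl, rfl⟩ | ⟨rfl, rfl⟩ : (x = 0 ∧ y = 1) ∨ (x = 1 ∧ y = 0) := by
      revert x y; decide
    exacts [h01, hG'.ristSection_le_add 0 1 1 h01]
  · have hN := normalizedBy_conjClosure G b
    have := self_mem_conjClosure G b
    refine ⟨swapAut * b * swapAut * b, mul_mem (hN _ ha _ this) this, fun w => ?_⟩
    simp [h.b_zero, h.b_one]
  · exact ⟨by simp [h.c_nil], 1, by decide, fun s => by simp [hc1]⟩
  · -- The commutator of `c a` and `b` has left section `c₀ c c₀ a`.
    have hN := normalizedBy_conjClosure G (c * swapAut)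
    have hm := self_mem_conjClosure G (c * swapAut)
    have hcomm := hN.commutator_mem hm hb
    have e : ∀ w, (c * swapAut * b * (c * swapAut)⁻¹ * b⁻¹) (0 :: w) =
        0 :: (c₀ * c * c₀ * swapAut) w := fun w => by
      simp [hb', hc', swapAut_inv, h.b_zero, h.b_one, h.c_zero]
    rcases h.c_eq with rfl | rfl
    · have := hG'.normalizedBy_sectionSubgroup hN 0 _ ha _ ⟨_, hcomm, e⟩
      simpa only [swapAut_inv, mul_assoc, ha', mul_one, ← mul_assoc swapAut swapAut, one_mul]
        using this
    · exact ⟨_, hcomm, by simpa using e⟩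

end IsBinarySystem

end Binary

/-! ### The ternary groups -/

section Ternary

@[simp] theorem rotAut_zero (w : List (Fin 3)) : rotAut (0 :: w) = 1 :: w := rfl
@[simp] theorem rotAut_one (w : List (Fin 3)) : rotAut (1 :: w) = 2 :: w := rfl
@[simp] theorem rotAut_two (w : List (Fin 3)) : rotAut (2 :: w) = 0 :: w := rfl
@[simp] theorem rotAut_inv_nil : rotAut⁻¹ [] = [] := rfl
@[simp] theorem rotAut_inv_zero (w : List (Fin 3)) : rotAut⁻¹ (0 :: w) = 2 :: w := rfl
@[simp] theorem rotAut_inv_one (w : List (Fin 3)) : rotAut⁻¹ (1 :: w) = 0 :: w := rfl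
@[simp] theorem rotAut_inv_two (w : List (Fin 3)) : rotAut⁻¹ (2 :: w) = 1 :: w := rfl

theorem rotMap_one (w : List (Fin 3)) : rotMap 1 w = rotAut w := rfl
theorem rotMap_neg_one (w : List (Fin 3)) : rotMap (-1) w = rotAut⁻¹ w := rfl

@[simp] theorem rotMap_zero (w : List (Fin 3)) : rotMap 0 w = w := by
  cases w <;> simp [rotMap]

@[simp] theorem spineAut_nil (k l : Fin 3) : spineAut k l [] = [] := rfl
@[simp] theorem spineAut_zero (k l : Fin 3) (w : List (Fin 3)) :
    spineAut k l (0 :: w) = 0 :: rotMap k w := rfl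
@[simp] theorem spineAut_one (k l : Fin 3) (w : List (Fin 3)) :
    spineAut k l (1 :: w) = 1 :: rotMap l w := rfl
@[simp] theorem spineAut_two (k l : Fin 3) (w : List (Fin 3)) :
    spineAut k l (2 :: w) = 2 :: spineAut k l w := rfl
@[simp] theorem spineAut_inv_zero (k l : Fin 3) (w : List (Fin 3)) :
    (spineAut k l)⁻¹ (0 :: w) = 0 :: rotMap (-k) w := rfl
@[simp] theorem spineAut_inv_one (k l : Fin 3) (w : List (Fin 3)) :
    (spineAut k l)⁻¹ (1 :: w) = 1 :: rotMap (-l) w := rfl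
@[simp] theorem spineAut_inv_two (k l : Fin 3) (w : List (Fin 3)) :
    (spineAut k l)⁻¹ (2 :: w) = 2 :: (spineAut k l)⁻¹ w := rfl

@[simp] theorem spineAut_singleton (k l s : Fin 3) : spineAut k l [s] = [s] := by
  fin_cases s <;> simp [rotMap]

theorem rotMap_append (k : Fin 3) (u : List (Fin 3)) :
    ∃ i, ∀ s, rotMap k (u ++ [s]) = rotMap k u ++ [s + i] := by
  cases u with
  | nil => exact ⟨k, fun s => rfl⟩
  | cons x u => exact ⟨0, fun s => by simp [rotMap]⟩

theorem rotAut_mem_cyclicAut : rotAut ∈ cyclicAut 3 := ⟨rfl, rotMap_append 1⟩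

theorem spineAut_mem_cyclicAut (k l : Fin 3) : spineAut k l ∈ cyclicAut 3 := by
  refine ⟨rfl, fun u => ?_⟩
  induction u with
  | nil => exact ⟨0, fun s => by simp⟩
  | cons x u ih =>
    fin_cases x
    · obtain ⟨i, hi⟩ := rotMap_append k u
      exact ⟨i, fun s => by simp [hi]⟩
    · obtain ⟨i, hi⟩ := rotMap_append l u
      exact ⟨i, fun s => by simp [hi]⟩
    · obtain ⟨i, hi⟩ := ih
      exact ⟨i, fun s => by simp [hi]⟩

/-- A predicate on pairs of distinct letters that is stable under rotation need only be checked
on the two pairs with first letter `1`. -/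
theorem Fin.pair_induction_of_rotation {p : Fin 3 → Fin 3 → Prop}
    (hp : ∀ x y k, p x y → p (x + k) (y + k)) (h₀ : p 1 0) (h₂ : p 1 2) {x y : Fin 3}
    (hxy : x ≠ y) : p x y := by
  have : (1 + (x - 1) = x ∧ 0 + (x - 1) = y) ∨ (1 + (x - 1) = x ∧ 2 + (x - 1) = y) := by
    revert x y; decide
  rcases this with ⟨h, h'⟩ | ⟨h, h'⟩
  · simpa only [h, h'] using hp 1 0 (x - 1) h₀
  · simpa only [h, h'] using hp 1 2 (x - 1) h₂

/-- The group generated by `a` and `g = (a, a ^ l, g)`. -/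
abbrev spineGroup (l : Fin 3) : Subgroup (TreeAut 3) := Subgroup.closure {rotAut, spineAut 1 l}

theorem rotAut_mem_spineGroup (l : Fin 3) : rotAut ∈ spineGroup l :=
  Subgroup.subset_closure (by simp)

theorem spineAut_mem_spineGroup (l : Fin 3) : spineAut 1 l ∈ spineGroup l :=
  Subgroup.subset_closure (by simp)

theorem selfReplicating_spineGroup (l : Fin 3) : SelfReplicating (spineGroup l) := by
  set G := spineGroup l with hG
  have ha : rotAut ∈ G := rotAut_mem_spineGroup l
  have hg : spineAut 1 l ∈ G := spineAut_mem_spineGroup l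
  have conj : ∀ {g}, g ∈ G → rotAut * g * rotAut⁻¹ ∈ G := fun h =>
    mul_mem (mul_mem ha h) (inv_mem ha)
  refine ⟨?_, fun k => ?_, fun y => ?_⟩
  · rw [hG, spineGroup, Subgroup.closure_le]
    rintro _ (rfl | rfl)
    exacts [rotAut_mem_cyclicAut, spineAut_mem_cyclicAut 1 l]
  · fin_cases k
    exacts [⟨1, one_mem _, fun x u => by simp⟩, ⟨rotAut, ha, fun x u => rfl⟩,
      ⟨rotAut⁻¹, inv_mem ha, fun x u => rfl⟩]
  · conv_lhs => rw [hG, spineGroup]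
    rw [Subgroup.closure_le]
    fin_cases y <;> rintro _ (rfl | rfl)
    · exact ⟨_, hg, fun w => rfl⟩
    · exact ⟨_, conj hg, fun w => by simp⟩
    · exact ⟨_, conj hg, fun w => by simp [rotMap_one]⟩
    · exact ⟨_, conj (conj hg), fun w => by simp⟩
    · exact ⟨_, conj (conj hg), fun w => by simp [rotMap_one]⟩
    · exact ⟨_, hg, fun w => rfl⟩

open scoped commutatorElement

/-- The elements `g = (a, a ^ l, g)`, `a g a⁻¹ = (g, a, a ^ l)` and `a⁻¹ g a = (a ^ l, g, a)` have
commutators with trivial section at the letter `1`, where the sections of the two entries are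
powers of `a`, and with section conjugate to `[a, g]` or its inverse at another letter. -/
theorem commutator_mem_ristSection (l x y : Fin 3) (hxy : x ≠ y) :
    ⁅rotAut, spineAut 1 l⁆ ∈ ristSection (spineGroup l) x y := by
  have hG := selfReplicating_spineGroup l
  have ha := rotAut_mem_spineGroup l
  have hg := spineAut_mem_spineGroup l
  have h₁ : rotAut * spineAut 1 l * rotAut⁻¹ ∈ spineGroup l :=
    mul_mem (mul_mem ha hg) (inv_mem ha)
  have h₂ : rotAut⁻¹ * spineAut 1 l * rotAut ∈ spineGroup l :=
    mul_mem (mul_mem (inv_mem ha) hg) ha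
  have comm : ∀ {g h : TreeAut 3}, g ∈ spineGroup l → h ∈ spineGroup l → ⁅g, h⁆ ∈ spineGroup l :=
    fun hg hh => mul_mem (mul_mem (mul_mem hg hh) (inv_mem hg)) (inv_mem hh)
  refine Fin.pair_induction_of_rotation
    (p := fun x y => ⁅rotAut, spineAut 1 l⁆ ∈ ristSection (spineGroup l) x y)
    (fun x y k h => hG.ristSection_le_add x y k h) ?_ ?_ hxy
  · refine ⟨_, ⟨comm hg h₁, fun u => ?_⟩, fun w => ?_⟩
    · cases u <;> simp [commutatorElement_def, rotMap]
      abel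
    · simp [commutatorElement_def, rotMap_one, rotMap_neg_one]
  · obtain rfl | rfl | rfl : l = 0 ∨ l = 1 ∨ l = -1 := by
      clear * -; revert l; decide
    · refine ⟨_, ⟨comm h₂ hg, fun u => ?_⟩, fun w => ?_⟩
      · simp [commutatorElement_def]
      · simp [commutatorElement_def, rotMap_one, rotMap_neg_one]
    · have : ⁅spineAut 1 1, rotAut⁆ ∈ ristSection (spineGroup 1) 1 2 := by
        refine ⟨_, ⟨comm hg h₁, fun u => ?_⟩, fun w => ?_⟩
        · cases u <;> simp [commutatorElement_def, rotMap]
        · simp [commutatorElement_def, rotMap_one, rotMap_neg_one]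
      simpa only [commutatorElement_inv] using inv_mem this
    · have : ⁅spineAut 1 (-1), rotAut⁻¹⁆ ∈ ristSection (spineGroup (-1)) 1 2 := by
        refine ⟨_, ⟨comm hg h₁, fun u => ?_⟩, fun w => ?_⟩
        · cases u <;> simp [commutatorElement_def, rotMap]
        · simp [commutatorElement_def, rotMap_one, rotMap_neg_one]
      have := hG.normalizedBy_ristSection 1 2 _ ha _ this
      simpa [commutatorElement_def, mul_assoc] using this

/-- Some conjugate of `g = (a, a ^ l, g)` rotates the children of a given letter and fixes those of
another given letter. -/
theorem exists_rotatesAt_letter_spineGroup (l x y : Fin 3) (hxy : x ≠ y) :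
    ∃ g ∈ spineGroup l, RotatesAt g [y] ∧ ∀ s, g [x, s] = [x, s] := by
  have ha := rotAut_mem_spineGroup l
  have hg := spineAut_mem_spineGroup l
  have h₂ : rotAut⁻¹ * spineAut 1 l * rotAut ∈ spineGroup l :=
    mul_mem (mul_mem (inv_mem ha) hg) ha
  refine Fin.pair_induction_of_rotation
    (p := fun x y => ∃ g ∈ spineGroup l, RotatesAt g [y] ∧ ∀ s, g [x, s] = [x, s])
    (fun x y k h => ?_) ?_ ?_ hxy
  · obtain ⟨g, hg, ⟨h, i, hi, e⟩, e'⟩ := h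
    obtain ⟨r, hr, hr'⟩ := (selfReplicating_spineGroup l).rotate k
    have hinv : ∀ z u, r⁻¹ ((z + k) :: u) = z :: u := fun z u => by
      rw [← hr', RelIso.inv_apply_self]
    refine ⟨r * g * r⁻¹, mul_mem (mul_mem hr hg) (inv_mem hr),
      ⟨by simp [hinv, h, hr'], i, hi, fun s => ?_⟩, fun s => by simp [hinv, e', hr']⟩
    have := e s
    simp only [List.cons_append, List.nil_append] at this
    simp [hinv, this, hr']
  · by_cases hl : l = 0
    · subst hl
      exact ⟨_, hg, ⟨by simp, 1, by decide, fun s => by simp [rotMap]⟩, fun s => by simp⟩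
    · exact ⟨_, h₂, ⟨by simp, l, hl, fun s => by simp [rotMap]⟩, fun s => by simp⟩
  · exact ⟨_, h₂, ⟨by simp, 1, by decide, fun s => by simp [rotMap]⟩, fun s => by simp⟩

theorem exists_fix_and_rotatesAt_spineGroup (l : Fin 3) (v w : List (Fin 3))
    (hvw : v.length = w.length + 1) (hne : v.take w.length ≠ w) :
    ∃ g ∈ spineGroup l, g v = v ∧ RotatesAt g w := by
  have hG := selfReplicating_spineGroup l
  have ha := rotAut_mem_spineGroup l
  have hg := spineAut_mem_spineGroup l
  -- The left section of `[a, g] = (a g a⁻¹) g⁻¹` is `g a⁻¹`.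
  have e : ∀ w, ⁅rotAut, spineAut 1 l⁆ (0 :: w) = 0 :: (spineAut 1 l * rotAut⁻¹) w :=
    fun w => by
      simp [commutatorElement_def, rotMap_neg_one]
  have hN := normalizedBy_conjClosure (spineGroup l) (spineAut 1 l * rotAut⁻¹)
  have hc := inv_mem (hN.commutator_mem (self_mem_conjClosure _ _) ha)
  refine hG.exists_fix_and_rotatesAt (exists_rotatesAt_letter_spineGroup l)
    (κ := ⁅rotAut, spineAut 1 l⁆)
    (μ := spineAut 1 l * rotAut⁻¹) (commutator_mem_ristSection l) (y₀ := 0) (y₁ := 0)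
    ⟨_, self_mem_conjClosure _ _, e⟩ ?_ ⟨_, hc, fun w => ?_⟩ v w hvw hne
  · exact ⟨by simp, -1, by decide, fun s => by fin_cases s <;> simp <;> decide⟩
  · rw [← e]
    simp [commutatorElement_def]

end Ternary

/-! ### Words of the points of the quotient by a vertex stabilizer -/

section Words

variable {d : ℕ}

variable (G : Subgroup (TreeAut d)) (v : List (Fin d))

/-- The `G`-set on which the quasi-regular representation of the stabilizer of `v` lives. -/
abbrev VertexQuotient := G ⧸ MulAction.stabilizer G v

variable {G v}

/-- The word `g v` of the coset of `g`. -/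
def word (x : VertexQuotient G v) : List (Fin d) := MulAction.ofQuotientStabilizer G v x

theorem word_smul (g : G) (x : VertexQuotient G v) :
    word (g • x) = (g : TreeAut d) (word x) :=
  MulAction.ofQuotientStabilizer_smul G v g x

theorem word_injective : Function.Injective (word : VertexQuotient G v → List (Fin d)) :=
  MulAction.injective_ofQuotientStabilizer G v

variable [NeZero d]

/-- The letter in position `m`, counted from `0`, of the word of `x`; only meaningful when `m` is
less than the length of `v`. -/
def letter (m : ℕ) (x : VertexQuotient G v) : Fin d := (word x).getD m 0

theorem take_succ_eq_append_getD {u : List (Fin d)} {m : ℕ} (hm : m < u.length) :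
    u.take (m + 1) = u.take m ++ [u.getD m 0] := by
  rw [List.take_succ_eq_append_getElem hm, List.getD_eq_getElem _ _ hm]

theorem cyclicAut.getD_apply {g : TreeAut d} (hg : g ∈ cyclicAut d) {u : List (Fin d)} {m : ℕ}
    (hm : m < u.length) {k : Fin d}
    (hk : ∀ s, g (u.take m ++ [s]) = g (u.take m) ++ [s + k]) :
    (g u).getD m 0 = u.getD m 0 + k := by
  have h := cyclicAut.take_apply hg (m + 1) u
  rw [take_succ_eq_append_getD hm, hk,
    take_succ_eq_append_getD (by rwa [cyclicAut.length_apply hg])] at h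
  exact List.singleton_inj.1 (List.append_inj_right' h rfl)

theorem take_word_smul (hG : SelfReplicating G) (g : G) (m : ℕ) (x : VertexQuotient G v) :
    (word (g • x)).take m = (g : TreeAut d) ((word x).take m) := by
  rw [word_smul, cyclicAut.take_apply (hG.cyclic g.2)]

theorem length_word (hG : SelfReplicating G) (x : VertexQuotient G v) :
    (word x).length = v.length := by
  induction x using QuotientGroup.induction_on with
  | H g => exact cyclicAut.length_apply (hG.cyclic g.2) v

theorem exists_word_eq (hG : SelfReplicating G) {w : List (Fin d)} (hw : w.length = v.length) :
    ∃ x : VertexQuotient G v, word x = w := by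
  obtain ⟨g, hg, h⟩ := hG.exists_apply_eq v w hw.symm
  exact ⟨QuotientGroup.mk (⟨g, hg⟩ : G), h⟩

/-- The points of the quotient are the words of the length of `v`. -/
noncomputable def wordEquiv (hG : SelfReplicating G) :
    VertexQuotient G v ≃ List.Vector (Fin d) v.length :=
  Equiv.ofBijective (fun x => ⟨word x, length_word hG x⟩)
    ⟨fun _ _ h => word_injective (congrArg Subtype.val h),
      fun w => (exists_word_eq hG w.2).imp fun _ h => Subtype.ext h⟩

theorem finite_vertexQuotient (hG : SelfReplicating G) : Finite (VertexQuotient G v) :=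
  Finite.of_equiv _ (wordEquiv hG).symm

theorem take_succ_word (hG : SelfReplicating G) {m : ℕ} (hm : m < v.length)
    (x : VertexQuotient G v) : (word x).take (m + 1) = (word x).take m ++ [letter m x] :=
  take_succ_eq_append_getD (by rwa [length_word hG])

theorem letter_smul (hG : SelfReplicating G) {m : ℕ} (hm : m < v.length) (g : G)
    (x : VertexQuotient G v) {k : Fin d}
    (hk : ∀ s, (g : TreeAut d) ((word x).take m ++ [s]) =
      (g : TreeAut d) ((word x).take m) ++ [s + k]) :
    letter m (g • x) = letter m x + k := by
  rw [letter, word_smul]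
  exact cyclicAut.getD_apply (hG.cyclic g.2) (by rwa [length_word hG]) hk

theorem letter_smul_sub_letter_smul (hG : SelfReplicating G) {m : ℕ} (hm : m < v.length) (g : G)
    {x y : VertexQuotient G v} (h : (word x).take m = (word y).take m) :
    letter m (g • y) - letter m (g • x) = letter m y - letter m x := by
  obtain ⟨k, hk⟩ := (hG.cyclic g.2).2 ((word x).take m)
  rw [letter_smul hG hm g x hk, letter_smul hG hm g y (by rwa [← h]), add_sub_add_right_eq_sub]

/-- The permutation that adds `k` to the letter in position `m`. -/
theorem exists_perm_add_letter (hG : SelfReplicating G) {m : ℕ} (hm : m < v.length) (k : Fin d) :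
    ∃ σ : Equiv.Perm (VertexQuotient G v), ∀ x, (∀ j ≤ m, (word (σ x)).take j = (word x).take j) ∧
      (∀ j < m, letter j (σ x) = letter j x) ∧ letter m (σ x) = letter m x + k := by
  have ex : ∀ (k : Fin d) (x : VertexQuotient G v), ∃ y : VertexQuotient G v,
      word y = (word x).modify m (· + k) := fun k x =>
    exists_word_eq hG (by rw [List.length_modify, length_word hG])
  choose σ hσ using ex
  have inv : ∀ k x, σ (-k) (σ k x) = x := fun k x => word_injective <| by
    rw [hσ, hσ, List.modify_modify_eq]
    have : ((· + -k) ∘ (· + k) : Fin d → Fin d) = id := by ext; simp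
    rw [this, List.modify_id]
  refine ⟨⟨σ k, σ (-k), inv k, fun x => by simpa using inv (-k) x⟩, fun x => ⟨fun j hj => ?_,
    fun j hj => ?_, ?_⟩⟩
  · rw [Equiv.coe_fn_mk, hσ, List.take_modify, List.modify_eq_self (by simp [hj])]
  · simp [letter, hσ, hj.ne']
  · have : m < (word x).length := by rwa [length_word hG]
    simp [letter, hσ, this]

end Words

/-! ### The components of the quasi-regular representation -/

section Components

variable {d : ℕ} [NeZero d] {G : Subgroup (TreeAut d)} {v : List (Fin d)}

theorem quasiRegular_apply {Γ : Type*} [Group Γ] (H : Subgroup Γ) (g : Γ)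
    (f : lp (fun _ : Γ ⧸ H => ℂ) 2) (x : Γ ⧸ H) : quasiRegular H g f x = f (g⁻¹ • x) := rfl

/-- The functions on the level of `v` that depend only on the first `m + 1` letters of a word, and
on the letter in position `m` through the character `χ`. -/
noncomputable def charComponent (hG : SelfReplicating G) {m : ℕ} (hm : m < v.length)
    (χ : AddChar (Fin d) ℂ) :
    Subrepresentation (quasiRegular (MulAction.stabilizer G v)) where
  toSubmodule :=
    { carrier := {f | ∀ x y, (word x).take m = (word y).take m →
        f y = χ (letter m y - letter m x) * f x}
      zero_mem' := fun x y _ => by simp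
      add_mem' := fun {f f'} hf hf' x y h => by
        simp [hf x y h, hf' x y h, mul_add]
      smul_mem' := fun c f hf x y h => by
        simp [hf x y h, mul_left_comm] }
  apply_mem_toSubmodule g f hf x y h := by
    have h' : (word (g⁻¹ • x)).take m = (word (g⁻¹ • y)).take m := by
      rw [take_word_smul hG, take_word_smul hG, h]
    rw [quasiRegular_apply, quasiRegular_apply, hf _ _ h', letter_smul_sub_letter_smul hG hm _ h]

variable (hG : SelfReplicating G)
include hG

/-- Restriction to the words `w00…0` with `w` of length `m` identifies a component with the
functions on the level `m`. -/
theorem finrank_charComponent {m : ℕ} (hm : m < v.length) (χ : AddChar (Fin d) ℂ) :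
    Module.finrank ℂ (charComponent hG hm χ).toSubmodule = d ^ m := by
  have := finite_vertexQuotient hG (v := v)
  have ex : ∀ w : List.Vector (Fin d) m, ∃ x : VertexQuotient G v, (word x).take m = w.1 ∧
      letter m x = 0 := fun w => by
    obtain ⟨x, hx⟩ := exists_word_eq hG (v := v) (w := w.1 ++ List.replicate (v.length - m) 0)
      (by simp [w.2]; omega)
    refine ⟨x, by simp [hx, w.2], ?_⟩
    have : m < (w.1 ++ List.replicate (v.length - m) (0 : Fin d)).length := by simp [w.2]; omega
    rw [letter, hx, List.getD_eq_getElem _ _ this, List.getElem_append_right (by simp [w.2])]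
    simp
  choose p hp hp' using ex
  let t : VertexQuotient G v → List.Vector (Fin d) m := fun x =>
    ⟨(word x).take m, by simp [length_word hG, hm.le]⟩
  let e : (charComponent hG hm χ).toSubmodule ≃ₗ[ℂ] (List.Vector (Fin d) m → ℂ) :=
    { toFun := fun f w => f.1 (p w)
      map_add' := fun _ _ => rfl
      map_smul' := fun _ _ => rfl
      invFun := fun φ => ⟨⟨fun x => χ (letter m x) * φ (t x), Memℓp.all _⟩, fun x y h => by
        have ht : t x = t y := Subtype.ext h
        simp only [ht]
        rw [← mul_assoc, ← AddChar.map_add_eq_mul, sub_add_cancel]⟩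
      left_inv := fun f => by
        ext x
        have := f.2 (p (t x)) x (hp _)
        rw [hp', sub_zero] at this
        exact this.symm
      right_inv := fun φ => by
        ext w
        have : t (p w) = w := Subtype.ext (hp w)
        simp [hp', this] }
  rw [e.finrank_eq, Module.finrank_fintype_fun_eq_card, card_vector, Fintype.card_fin]

/-- Translating the letter in the later of the two positions multiplies the inner product by a
nontrivial scalar of modulus one, so the inner product vanishes. -/
theorem charComponent_isOrtho {m m' : ℕ} (hm : m < v.length) (hm' : m' < v.length)
    {χ χ' : AddChar (Fin d) ℂ} (h : (m < m' ∧ χ' ≠ 1) ∨ (m = m' ∧ χ ≠ χ')) :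
    (charComponent hG hm χ).toSubmodule ⟂ (charComponent hG hm' χ').toSubmodule := by
  rw [Submodule.isOrtho_iff_inner_eq]
  intro f hf f' hf'
  have key : ∀ (σ : Equiv.Perm (VertexQuotient G v)) (c c' : ℂ), (∀ x, f (σ x) = c * f x) →
      (∀ x, f' (σ x) = c' * f' x) → c' * (starRingEnd ℂ) c ≠ 1 → inner ℂ f f' = 0 := by
    intro σ c c' hc hc' hne
    have : inner ℂ f f' = c' * (starRingEnd ℂ) c * inner ℂ f f' := by
      conv_lhs => rw [lp.inner_eq_tsum, ← σ.tsum_eq]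
      rw [lp.inner_eq_tsum, ← tsum_mul_left]
      refine tsum_congr fun x => ?_
      simp only [hc, hc', RCLike.inner_apply, map_mul]
      ring
    by_contra h0
    exact hne (mul_right_cancel₀ h0 (by rw [← this, one_mul]))
  obtain ⟨hlt, hχ⟩ | ⟨rfl, hχ⟩ := h
  · obtain ⟨k, hk⟩ := AddChar.ne_one_iff.1 hχ
    obtain ⟨σ, hσ⟩ := exists_perm_add_letter hG hm' k
    refine key σ 1 (χ' k) (fun x => ?_) (fun x => ?_) (by simpa using hk)
    · rw [hf x (σ x) ((hσ x).1 m hlt.le).symm, (hσ x).2.1 m hlt, sub_self]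
      simp
    · rw [hf' x (σ x) ((hσ x).1 m' le_rfl).symm, (hσ x).2.2, add_sub_cancel_left]
  · obtain ⟨k, hk⟩ := DFunLike.ne_iff.1 hχ
    obtain ⟨σ, hσ⟩ := exists_perm_add_letter hG hm' k
    refine key σ (χ k) (χ' k) (fun x => ?_) (fun x => ?_) fun he => hk ?_
    · rw [hf x (σ x) ((hσ x).1 m le_rfl).symm, (hσ x).2.2, add_sub_cancel_left]
    · rw [hf' x (σ x) ((hσ x).1 m le_rfl).symm, (hσ x).2.2, add_sub_cancel_left]
    · rw [← AddChar.map_neg_eq_conj, AddChar.map_neg_eq_inv] at he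
      exact (eq_of_div_eq_one he).symm

/-- A function in a component supported on the words with prefix `w` is an eigenvector of each
element that fixes `w`. -/
theorem quasiRegular_apply_of_support {m : ℕ} (hm : m < v.length) {χ : AddChar (Fin d) ℂ}
    {f : lp (fun _ : VertexQuotient G v => ℂ) 2} (hf : f ∈ (charComponent hG hm χ).toSubmodule)
    {w : List (Fin d)} (hs : ∀ x, (word x).take m ≠ w → f x = 0) {g : G} {k : Fin d}
    (hw : (g : TreeAut d) w = w) (hg : ∀ s, (g : TreeAut d) (w ++ [s]) = w ++ [s + k]) :
    quasiRegular (MulAction.stabilizer G v) g f = χ (-k) • f := by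
  ext x
  rw [quasiRegular_apply, lp.coeFn_smul, Pi.smul_apply, smul_eq_mul]
  have hinv : (word (g⁻¹ • x)).take m = w ↔ (word x).take m = w := by
    rw [take_word_smul hG]
    constructor
    · intro h
      rw [← hw, ← h]
      simp
    · intro h
      rw [h]
      conv_lhs => rw [← hw]
      simp
  by_cases hx : (word x).take m = w
  · have h1 := hinv.2 hx
    have := letter_smul hG hm g (g⁻¹ • x) (k := k) (by simpa only [h1, hw] using hg)
    rw [smul_inv_smul] at this
    rw [hf x _ (hx.trans h1.symm), this, sub_add_cancel_left]
  · rw [hs x hx, hs _ (hinv.not.2 hx), mul_zero]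

/-- Elements rotating below a vertex `w` of level `m` and fixing a word of length `m + 1` not below
`w` force the functions of a component that they fix to vanish below `w`. -/
theorem eq_zero_of_fixed
    (hsep : ∀ v w : List (Fin d), v.length = w.length + 1 → v.take w.length ≠ w →
      ∃ g ∈ G, g v = v ∧ RotatesAt g w)
    {m : ℕ} (hm : m < v.length) {χ : AddChar (Fin d) ℂ}
    (hχ : m = 0 ∨ ∀ k, k ≠ 0 → χ k ≠ 1)
    {f : lp (fun _ : VertexQuotient G v => ℂ) 2} (hf : f ∈ (charComponent hG hm χ).toSubmodule)
    {u : List (Fin d)} (hu : u.length = m + 1)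
    (hfix : ∀ g : G, (g : TreeAut d) u = u → ∀ x, f (g • x) = f x)
    {x : VertexQuotient G v} (hx : (word x).take m ≠ u.take m) : f x = 0 := by
  rcases hχ with rfl | hχ
  · simp at hx
  have hl : ((word x).take m).length = m := by simp [length_word hG, hm.le]
  obtain ⟨g, hg, hgu, hw, k, hk, e⟩ := hsep u ((word x).take m) (by rw [hl, hu])
    (by rw [hl]; exact hx.symm)
  have h1 := hfix ⟨g, hg⟩ hgu x
  have h2 : (word ((⟨g, hg⟩ : G) • x)).take m = (word x).take m := by
    rw [take_word_smul hG]; exact hw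
  have h3 : letter m ((⟨g, hg⟩ : G) • x) = letter m x + k :=
    letter_smul hG hm ⟨g, hg⟩ x (by simpa only [hw] using e)
  rw [hf x _ h2.symm, h3, add_sub_cancel_left] at h1
  by_contra h0
  exact hχ k hk (mul_right_cancel₀ h0 (by rw [h1, one_mul]))

end Components

/-! ### Irreducibility -/

section Irreducible

/-- Averaging over a subgroup `K` of a group acting on a finite quotient: an invariant subspace
that contains a function constant and nonzero on the `K`-orbit of `x₀` contains a `K`-invariant
function that does not vanish at `x₀`. -/
theorem exists_invariant_of_mem {Γ : Type*} [Group Γ] {H : Subgroup Γ} [Finite (Γ ⧸ H)]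
    {U : Submodule ℂ (lp (fun _ : Γ ⧸ H => ℂ) 2)}
    (hU : ∀ g, ∀ f ∈ U, quasiRegular H g f ∈ U) {f : lp (fun _ : Γ ⧸ H => ℂ) 2} (hf : f ∈ U)
    (K : Subgroup Γ) {x₀ : Γ ⧸ H} (h₀ : f x₀ ≠ 0) (hK : ∀ g ∈ K, f (g • x₀) = f x₀) :
    ∃ F ∈ U, F x₀ ≠ 0 ∧ ∀ g ∈ K, ∀ x, F (g • x) = F x := by
  classical
  -- The sum runs over the image of `K` in the finite permutation group of the quotient.
  let Q : Subgroup (Equiv.Perm (Γ ⧸ H)) := K.map (MulAction.toPermHom Γ (Γ ⧸ H))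
  have : Fintype Q := Fintype.ofFinite Q
  have ex : ∀ σ : Q, ∃ g ∈ K, ∀ x, g • x = σ.1 x := by
    rintro ⟨_, g, hg, rfl⟩
    exact ⟨g, hg, fun x => rfl⟩
  choose γ hγ hγ' using ex
  have hF : ∀ x, (∑ σ : Q, quasiRegular H (γ σ)⁻¹ f) x = ∑ σ : Q, f (σ.1 x) := fun x => by
    rw [lp.coeFn_sum, Finset.sum_apply]
    exact Finset.sum_congr rfl fun σ _ => by rw [quasiRegular_apply, inv_inv, hγ']
  refine ⟨∑ σ : Q, quasiRegular H (γ σ)⁻¹ f, U.sum_mem fun σ _ => hU _ f hf, ?_,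
    fun g hg x => ?_⟩
  · have : ∀ σ : Q, f (σ.1 x₀) = f x₀ := fun σ => by rw [← hγ', hK _ (hγ σ)]
    rw [hF, Finset.sum_congr rfl fun σ _ => this σ]
    simp [h₀]
  · rw [hF, hF]
    exact Fintype.sum_equiv (Equiv.mulRight ⟨MulAction.toPermHom Γ (Γ ⧸ H) g, g, hg, rfl⟩) _ _
      fun σ => rfl

variable {d : ℕ} [NeZero d] {G : Subgroup (TreeAut d)} {v : List (Fin d)}
  (hG : SelfReplicating G)
include hG

/-- A nonzero function in a component supported on the words with one prefix of length `m`
generates the component, as `G` is transitive on the vertices of level `m`. -/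
theorem charComponent_le_of_support {m : ℕ} (hm : m < v.length) {χ : AddChar (Fin d) ℂ}
    {U : Submodule ℂ (lp (fun _ : VertexQuotient G v => ℂ) 2)}
    (hU : ∀ g, ∀ f ∈ U, quasiRegular (MulAction.stabilizer G v) g f ∈ U)
    {F : lp (fun _ : VertexQuotient G v => ℂ) 2} (hF : F ∈ U)
    (hFW : F ∈ (charComponent hG hm χ).toSubmodule) {x₀ : VertexQuotient G v} (h₀ : F x₀ ≠ 0)
    (hs : ∀ x, (word x).take m ≠ (word x₀).take m → F x = 0) :
    (charComponent hG hm χ).toSubmodule ≤ U := by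
  intro f hf
  have ex : ∀ w : List.Vector (Fin d) m, ∃ g : G, (g : TreeAut d) ((word x₀).take m) = w.1 :=
    fun w => by
      obtain ⟨g, hg, h⟩ := hG.exists_apply_eq ((word x₀).take m) w.1
        (by simp [length_word hG, hm.le, w.2])
      exact ⟨⟨g, hg⟩, h⟩
  choose γ hγ using ex
  let φ : VertexQuotient G v → ℂ := f
  let Φ : VertexQuotient G v → ℂ := F
  have key : ∀ x, φ x =
      ∑ w : List.Vector (Fin d) m, φ (γ w • x₀) / Φ x₀ * Φ ((γ w)⁻¹ • x) := fun x => by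
    have hinv : ∀ w, (word ((γ w)⁻¹ • x)).take m = (word x₀).take m ↔ (word x).take m = w.1 := by
      intro w
      rw [take_word_smul hG, ← hγ w]
      constructor
      · intro h
        rw [← h]
        simp
      · intro h
        rw [h]
        simp
    have hl : ((word x).take m).length = m := by simp [length_word hG, hm.le]
    obtain ⟨w, hw⟩ : ∃ w : List.Vector (Fin d) m, w.1 = (word x).take m := ⟨⟨_, hl⟩, rfl⟩
    have h1 := (hinv w).2 hw.symm
    have h2 := letter_smul_sub_letter_smul hG hm (γ w) h1.symm
    rw [smul_inv_smul] at h2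
    have h3 : φ x = χ (letter m x - letter m (γ w • x₀)) * φ (γ w • x₀) :=
      hf (γ w • x₀) x (by rw [take_word_smul hG, hγ w, hw])
    have h4 : Φ ((γ w)⁻¹ • x) = χ (letter m x - letter m (γ w • x₀)) * Φ x₀ := by
      rw [h2]
      exact hFW _ _ h1.symm
    have h5 : Φ x₀ ≠ 0 := h₀
    have h6 : φ x = φ (γ w • x₀) / Φ x₀ * Φ ((γ w)⁻¹ • x) := by
      rw [h4, h3]
      field_simp
    refine h6.trans (Fintype.sum_eq_single
      (f := fun w => φ (γ w • x₀) / Φ x₀ * Φ ((γ w)⁻¹ • x)) w fun w' hw' => ?_).symm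
    have h7 : Φ ((γ w')⁻¹ • x) = 0 := hs _ fun h => 
      hw' (Subtype.ext (((hinv w').1 h).symm.trans hw.symm))
    rw [h7, mul_zero]
  have e : f = ∑ w : List.Vector (Fin d) m,
      (f (γ w • x₀) / F x₀) • quasiRegular (MulAction.stabilizer G v) (γ w) F := by
    ext x
    rw [lp.coeFn_sum, Finset.sum_apply]
    exact key x
  rw [e]
  exact U.sum_mem fun w _ => U.smul_mem _ (hU _ _ hF)

variable (hsep : ∀ v w : List (Fin d), v.length = w.length + 1 → v.take w.length ≠ w →
      ∃ g ∈ G, g v = v ∧ RotatesAt g w)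
include hsep

theorem charComponent_le_of_invariant {m : ℕ} (hm : m < v.length) {χ : AddChar (Fin d) ℂ}
    (hχ : m = 0 ∨ ∀ k, k ≠ 0 → χ k ≠ 1)
    {U : Submodule ℂ (lp (fun _ : VertexQuotient G v => ℂ) 2)}
    (hU : ∀ g, ∀ f ∈ U, quasiRegular (MulAction.stabilizer G v) g f ∈ U)
    (hUW : U ≤ (charComponent hG hm χ).toSubmodule) (hne : U ≠ ⊥) :
    (charComponent hG hm χ).toSubmodule ≤ U := by
  have := finite_vertexQuotient hG (v := v)
  obtain ⟨f, hf, hf0⟩ := Submodule.exists_mem_ne_zero_of_ne_bot hne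
  obtain ⟨x₀, hx₀⟩ : ∃ x, f x ≠ 0 := by
    by_contra! h
    exact hf0 (by ext x; simpa using h x)
  -- Functions in the component depend only on the first `m + 1` letters.
  have hu : ((word x₀).take (m + 1)).length = m + 1 := by
    rw [List.length_take, length_word hG]; omega
  have hut : ((word x₀).take (m + 1)).take m = (word x₀).take m := by simp [List.take_take]
  obtain ⟨F, hF, h₀, hK⟩ := exists_invariant_of_mem hU hf
    (MulAction.stabilizer G ((word x₀).take (m + 1))) hx₀ fun g hg => by
      have h1 : (word (g • x₀)).take (m + 1) = (word x₀).take (m + 1) := by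
        rw [take_word_smul hG]; exact hg
      rw [take_succ_word hG hm, take_succ_word hG hm] at h1
      obtain ⟨h2, h3⟩ := List.append_inj' h1 rfl
      rw [hUW hf x₀ _ h2.symm, List.singleton_inj.1 h3]
      simp
  refine charComponent_le_of_support hG hm hU hF (hUW hF) h₀ fun x hx => ?_
  exact eq_zero_of_fixed hG hsep hm hχ (hUW hF) hu (fun g hg => hK g hg) (by rwa [hut])

theorem charComponent_isIrreducible {m : ℕ} (hm : m < v.length) {χ : AddChar (Fin d) ℂ}
    (hχ : m = 0 ∨ ∀ k, k ≠ 0 → χ k ≠ 1) :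
    (charComponent hG hm χ).toRepresentation.IsIrreducible := by
  set W := charComponent hG hm χ with hW
  have : Nontrivial W.toSubmodule := by
    apply Module.nontrivial_of_finrank_pos (R := ℂ)
    rw [finrank_charComponent]
    exact pow_pos (Nat.pos_of_ne_zero (NeZero.ne d)) m
  refine { exists_pair_ne := ⟨⊥, ⊤, fun h => ?_⟩, eq_bot_or_eq_top := fun U => ?_ }
  · exact bot_ne_top (α := Submodule ℂ W.toSubmodule) (congrArg Subrepresentation.toSubmodule h)
  · by_cases hne : U.toSubmodule = ⊥
    · exact .inl (Subrepresentation.toSubmodule_injective hne)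
    refine .inr (Subrepresentation.toSubmodule_injective (eq_top_iff.2 fun f _ => ?_))
    have hle := charComponent_le_of_invariant hG hsep hm hχ
      (U := U.toSubmodule.map W.toSubmodule.subtype) ?_ (Submodule.map_subtype_le _ _) ?_
    · obtain ⟨f', hf', e⟩ := hle f.2
      rwa [Subtype.ext e] at hf'
    · rintro g _ ⟨f, hf, rfl⟩
      exact ⟨W.toRepresentation g f, U.apply_mem_toSubmodule g hf, rfl⟩
    · rwa [Ne, ← Submodule.map_bot W.toSubmodule.subtype,
        (Submodule.map_injective_of_injective W.toSubmodule.injective_subtype).eq_iff]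

/-- Components of different degrees are not isomorphic. For equal degrees, an isomorphism sends a
function supported below one vertex of level `m` to such a function, and the elements fixing that
vertex act on both through the characters. -/
theorem isEmpty_equiv_charComponent (hd : 1 < d) {m m' : ℕ} (hm : m < v.length)
    (hm' : m' < v.length) {χ χ' : AddChar (Fin d) ℂ}
    (hχ' : m' = 0 ∨ ∀ k, k ≠ 0 → χ' k ≠ 1) (hne : (m, χ) ≠ (m', χ')) :
    IsEmpty (Representation.Equiv (charComponent hG hm χ).toRepresentation
      (charComponent hG hm' χ').toRepresentation) := by
  refine ⟨fun T => ?_⟩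
  have hmm : m = m' := by
    have := T.toLinearEquiv.finrank_eq
    rw [finrank_charComponent, finrank_charComponent] at this
    exact Nat.pow_right_injective hd this
  subst hmm
  have hχχ : χ ≠ χ' := fun h => hne (by rw [h])
  obtain ⟨k, hk⟩ := DFunLike.ne_iff.1 hχχ
  have := finite_vertexQuotient hG (v := v)
  obtain ⟨x₀, -⟩ := exists_word_eq hG (v := v) (w := v) rfl
  -- The function `f` is supported on the words that agree with `x₀` in the first `m` letters.
  classical
  let f : lp (fun _ : VertexQuotient G v => ℂ) 2 :=
    ⟨fun x => if (word x).take m = (word x₀).take m then χ (letter m x) else 0, Memℓp.all _⟩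
  have hf : f ∈ (charComponent hG hm χ).toSubmodule := fun x y h => by
    by_cases hx : (word x).take m = (word x₀).take m
    · simp only [f, hx, ← h, if_true]
      rw [← AddChar.map_add_eq_mul, sub_add_cancel]
    · simp [f, hx, ← h]
  have hfs : ∀ x, (word x).take m ≠ (word x₀).take m → f x = 0 := fun x hx => if_neg hx
  have hf0 : f ≠ 0 := fun h => by
    have h1 : f x₀ = χ (letter m x₀) := if_pos rfl
    rw [h] at h1
    exact (χ.val_isUnit (letter m x₀)).ne_zero h1.symm
  set w := (word x₀).take m with hw
  have hwl : w.length = m := by simp [hw, length_word hG, hm.le]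
  set f' := T ⟨f, hf⟩ with hf'
  have hf'0 : (f' : lp (fun _ : VertexQuotient G v => ℂ) 2) ≠ 0 := by
    simpa [hf'] using hf0
  have hT : ∀ (g : G) (c : ℂ), quasiRegular (MulAction.stabilizer G v) g f = c • f →
      quasiRegular (MulAction.stabilizer G v) g f'.1 = c • f'.1 := by
    intro g c h
    have h1 : (charComponent hG hm χ).toRepresentation g ⟨f, hf⟩ = c • ⟨f, hf⟩ := Subtype.ext h
    have h2 := LinearMap.congr_fun (T.isIntertwining' g) ⟨f, hf⟩
    have h3 : T ((charComponent hG hm χ).toRepresentation g ⟨f, hf⟩) =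
      (charComponent hG hm' χ').toRepresentation g f' := h2
    rw [h1, map_smul] at h3
    exact (congrArg Subtype.val h3).symm
  have hu : (w ++ [letter m x₀]).length = m + 1 := by simp [hwl]
  have hrot : ∀ (g : G) (k : Fin d), (g : TreeAut d) (w ++ [letter m x₀]) =
      w ++ [letter m x₀ + k] →
      (g : TreeAut d) w = w ∧ ∀ s, (g : TreeAut d) (w ++ [s]) = w ++ [s + k] := by
    intro g k h
    obtain ⟨l, hl⟩ := (hG.cyclic g.2).2 w
    have h1 := (hl _).symm.trans h
    obtain ⟨h2, h3⟩ := List.append_inj' h1 rfl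
    have h3 : l = k := by simpa using h3
    exact ⟨h2, fun s => by rw [hl, h2, h3]⟩
  have hfs' : ∀ x, (word x).take m ≠ w → f'.1 x = 0 := fun x hx => by
    refine eq_zero_of_fixed hG hsep hm hχ' f'.2 hu (fun g hg x => ?_) (by simpa [hwl] using hx)
    obtain ⟨h1, h2⟩ := hrot g⁻¹ 0 (by
      rw [add_zero, Subgroup.coe_inv]
      conv_lhs => rw [← hg]
      simp)
    have h3 := hT g⁻¹ (χ (-0)) (quasiRegular_apply_of_support hG hm hf hfs h1 h2)
    have h4 := congrArg (fun φ : lp (fun _ : VertexQuotient G v => ℂ) 2 => φ x) h3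
    simpa [quasiRegular_apply] using h4
  obtain ⟨g, hg, hgw⟩ := hG.exists_apply_eq (w ++ [letter m x₀]) (w ++ [letter m x₀ + -k])
    (by simp)
  obtain ⟨h1, h2⟩ := hrot ⟨g, hg⟩ (-k) hgw
  have h3 := hT ⟨g, hg⟩ _ (quasiRegular_apply_of_support hG hm hf hfs h1 h2)
  rw [quasiRegular_apply_of_support hG hm f'.2 hfs' h1 h2, neg_neg] at h3
  exact hk (smul_left_injective ℂ hf'0 h3).symm

end Irreducible

/-! ### The decomposition -/

section Decomposition

variable {d : ℕ} [NeZero d]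

/-- The index set of the components for words of length `n`: all characters for the letter in
position `0`, the nontrivial characters for the letter in each later position. -/
abbrev ComponentIndex (d n : ℕ) [NeZero d] :=
  AddChar (Fin d) ℂ ⊕ (Fin (n - 1) × {χ : AddChar (Fin d) ℂ // χ ≠ 1})

namespace ComponentIndex

variable {n : ℕ}

/-- The position of the letter on which the component depends through a character. -/
def position : ComponentIndex d n → ℕ := Sum.elim (fun _ => 0) fun p => p.1 + 1

/-- The character by which the component depends on that letter. -/
def character : ComponentIndex d n → AddChar (Fin d) ℂ := Sum.elim id fun p => p.2

theorem position_lt (hn : 1 ≤ n) (i : ComponentIndex d n) : i.position < n := by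
  rcases i with χ | ⟨i, χ⟩ <;> simp only [position, Sum.elim_inl, Sum.elim_inr] <;> omega

theorem position_eq_zero_or (i : ComponentIndex d n) : i.position = 0 ∨ i.character ≠ 1 := by
  rcases i with χ | ⟨i, χ⟩
  exacts [.inl rfl, .inr χ.2]

theorem pair_injective :
    Function.Injective fun i : ComponentIndex d n => (i.position, i.character) := by
  rintro (χ | ⟨i, χ⟩) (χ' | ⟨i', χ'⟩) h <;>
    simp only [position, character, Sum.elim_inl, Sum.elim_inr, Prod.mk.injEq, id] at h
  · rw [h.2]
  · omega
  · omega
  · obtain rfl : i = i' := Fin.ext (by omega)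
    rw [Subtype.ext h.2]

theorem card_characters : Fintype.card (AddChar (Fin d) ℂ) = d := by
  rw [AddChar.card_eq, Fintype.card_fin]

theorem card_nontrivial_characters :
    Fintype.card {χ : AddChar (Fin d) ℂ // χ ≠ 1} = d - 1 := by
  classical
  rw [Fintype.card_subtype_compl, card_characters, Fintype.card_subtype_eq]

theorem card_eq : Fintype.card (ComponentIndex d n) = d + (n - 1) * (d - 1) := by
  rw [Fintype.card_sum, Fintype.card_prod, card_characters, card_nontrivial_characters,
    Fintype.card_fin]

/-- The multiset of the dimensions of the components. -/
theorem map_pow_position (hn : 1 ≤ n) :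
    (Finset.univ : Finset (ComponentIndex d n)).val.map (fun i => d ^ i.position) =
      Multiset.replicate d 1 + (Multiset.Ico 1 n).bind fun i => Multiset.replicate (d - 1) (d ^ i)
    := by
  have h₁ : (Finset.univ : Finset (ComponentIndex d n)).val =
      (Finset.univ : Finset (AddChar (Fin d) ℂ)).val.disjSum
        (Finset.univ : Finset (Fin (n - 1) × {χ : AddChar (Fin d) ℂ // χ ≠ 1})).val := rfl
  have h₂ : (Finset.univ : Finset (Fin (n - 1) × {χ : AddChar (Fin d) ℂ // χ ≠ 1})).val =
      (Finset.univ : Finset (Fin (n - 1))).val.bind fun i =>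
        (Finset.univ : Finset {χ : AddChar (Fin d) ℂ // χ ≠ 1}).val.map (Prod.mk i) := rfl
  have h₃ : Multiset.Ico 1 n = (Finset.univ : Finset (Fin (n - 1))).val.map fun i => i.1 + 1 := by
    obtain ⟨m, rfl⟩ := Nat.exists_eq_add_of_le' hn
    have h₄ := Multiset.map_add_right_Ico 0 m 1
    rw [zero_add] at h₄
    have h₅ : Multiset.Ico 0 m = (Finset.univ : Finset (Fin m)).val.map Fin.val := by
      rw [Multiset.Ico, Nat.Ico_zero_eq_range, ← Nat.Iio_eq_range, ← Fin.map_valEmbedding_univ]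
      rfl
    rw [← h₄, h₅, Multiset.map_map]
    rfl
  rw [h₁, Multiset.map_disjSum, h₂, Multiset.map_bind, h₃, Multiset.bind_map]
  simp only [position, Sum.elim_inl, Sum.elim_inr, pow_zero, Multiset.map_const', Multiset.map_map,
    Function.comp_def, Finset.card_val, Finset.card_univ, card_characters,
    card_nontrivial_characters]

theorem sum_pow_position (hn : 1 ≤ n) : ∑ i : ComponentIndex d n, d ^ i.position = d ^ n := by
  rw [Fintype.sum_sum_type, Fintype.sum_prod_type]
  simp only [position, Sum.elim_inl, Sum.elim_inr, Finset.sum_const, Finset.card_univ,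
    card_characters, card_nontrivial_characters, pow_zero, smul_eq_mul, mul_one]
  obtain ⟨m, rfl⟩ := Nat.exists_eq_add_of_le' hn
  obtain ⟨e, rfl⟩ := Nat.exists_eq_succ_of_ne_zero (NeZero.ne d)
  rw [Nat.add_sub_cancel, Fin.sum_univ_eq_sum_range (fun i => (e + 1 - 1) * (e + 1) ^ (i + 1))]
  clear hn
  induction m with
  | zero => simp
  | succ m ih =>
    rw [Finset.sum_range_succ, ← add_assoc, ih, Nat.add_sub_cancel, Nat.succ_eq_add_one]
    ring

end ComponentIndex

/-- A nontrivial character of a group of prime order takes the value `1` only at `0`. -/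
theorem AddChar.apply_ne_one_of_prime (hd : d.Prime) {χ : AddChar (Fin d) ℂ} (hχ : χ ≠ 1)
    {k : Fin d} (hk : k ≠ 0) : χ k ≠ 1 := by
  intro h
  have := Fact.mk hd
  refine hχ (AddChar.ext _ _ fun s => ?_)
  obtain ⟨j, rfl⟩ := AddSubgroup.mem_zmultiples_iff.1
    (mem_zmultiples_of_prime_card (p := d) (by simp) hk (g' := s))
  rw [AddChar.map_zsmul_eq_zpow, h, one_zpow, AddChar.one_apply]

/-- For a self-replicating group whose vertex stabilizers separate vertices, over an alphabet of
prime size, the components indexed by `ComponentIndex` decompose the quasi-regular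
representation. -/
theorem splitsIntoDistinctIrreducibles_quasiRegular (hd : d.Prime) {G : Subgroup (TreeAut d)}
    (hG : SelfReplicating G)
    (hsep : ∀ v w : List (Fin d), v.length = w.length + 1 → v.take w.length ≠ w →
      ∃ g ∈ G, g v = v ∧ RotatesAt g w) {v : List (Fin d)} (hv : 1 ≤ v.length) :
    SplitsIntoDistinctIrreducibles (quasiRegular (MulAction.stabilizer G v))
      (d + (v.length - 1) * (d - 1))
      (Multiset.replicate d 1 +
        (Multiset.Ico 1 v.length).bind fun i => Multiset.replicate (d - 1) (d ^ i)) := by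
  have hfin := finite_vertexQuotient hG (v := v)
  let e : Fin (d + (v.length - 1) * (d - 1)) ≃ ComponentIndex d v.length :=
    (finCongr ComponentIndex.card_eq.symm).trans (Fintype.equivFin _).symm
  let W : ComponentIndex d v.length →
      Subrepresentation (quasiRegular (MulAction.stabilizer G v)) :=
    fun i => charComponent hG (i.position_lt hv) i.character
  have hχ : ∀ i : ComponentIndex d v.length, i.position = 0 ∨ ∀ k, k ≠ 0 → i.character k ≠ 1 :=
    fun i => i.position_eq_zero_or.imp_right fun h k hk => AddChar.apply_ne_one_of_prime hd h hk
  have hrank : ∀ i, Module.finrank ℂ (W i).toSubmodule = d ^ i.position :=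
    fun i => finrank_charComponent hG (i.position_lt hv) i.character
  have hne : ∀ {i j}, i ≠ j → (e i).position = (e j).position →
      (e i).character ≠ (e j).character := fun hij hp hc =>
    hij (e.injective (ComponentIndex.pair_injective (Prod.ext hp hc)))
  have hortho : Pairwise fun i j => (W (e i)).toSubmodule ⟂ (W (e j)).toSubmodule := by
    intro i j hij
    rcases lt_trichotomy (e i).position (e j).position with h | h | h
    · refine charComponent_isOrtho hG _ _ (.inl ⟨h, ?_⟩)
      exact (e j).position_eq_zero_or.resolve_left (by omega)
    · exact charComponent_isOrtho hG _ _ (.inr ⟨h, hne hij h⟩)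
    · refine (charComponent_isOrtho hG _ _ (.inl ⟨h, ?_⟩)).symm
      exact (e i).position_eq_zero_or.resolve_left (by omega)
  refine ⟨fun i => W (e i), ?_, hortho, fun i => ?_, fun i j hij => ?_, ?_⟩
  · have hind := (OrthogonalFamily.of_pairwise hortho).independent
    have hfr : Module.finrank ℂ (lp (fun _ : VertexQuotient G v => ℂ) 2) = d ^ v.length := by
      have := Fintype.ofFinite (VertexQuotient G v)
      rw [(lpPiLpₗᵢ (fun _ : VertexQuotient G v => ℂ) ℂ (p := 2)).toLinearEquiv.finrank_eq,
        finrank_euclideanSpace, Fintype.card_congr (wordEquiv hG), card_vector, Fintype.card_fin]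
    have hfd : FiniteDimensional ℂ (lp (fun _ : VertexQuotient G v => ℂ) 2) :=
      Module.finite_of_finrank_pos (by rw [hfr]; exact pow_pos hd.pos _)
    have hinj : Function.Injective
      (DirectSum.coeLinearMap fun i => (W (e i)).toSubmodule) := hind.dfinsupp_lsum_injective
    refine ⟨hinj, (LinearMap.injective_iff_surjective_of_finrank_eq_finrank ?_).1 hinj⟩
    rw [hfr, Module.finrank_directSum, ← ComponentIndex.sum_pow_position hv, ← e.sum_comp]
    exact Finset.sum_congr rfl fun i _ => hrank (e i)
  · exact charComponent_isIrreducible hG hsep _ (hχ (e i))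
  · exact isEmpty_equiv_charComponent hG hsep hd.one_lt _ _ (hχ (e j)) fun h =>
      hne hij (congrArg Prod.fst h) (congrArg Prod.snd h)
  · rw [← ComponentIndex.map_pow_position hv, ← Multiset.map_univ_val_equiv e, Multiset.map_map]
    exact Multiset.map_congr rfl fun i _ => hrank (e i)

end Decomposition

theorem mainTheorem4 (n : ℕ) (hn : 1 ≤ n) :
    (∀ G : Subgroup (TreeAut 2), G = grigorchukGroup ∨ G = grigorchukTildeGroup →
      ∀ v : List (Fin 2), v.length = n →
        SplitsIntoDistinctIrreducibles (quasiRegular (MulAction.stabilizer G v)) (n + 1)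
          ({1, 1} + (Multiset.Ico 1 n).map (fun i => 2 ^ i))) ∧
    (∀ G : Subgroup (TreeAut 3),
      G = gammaGroup ∨ G = gammaBarGroup ∨ G = guptaSidkiGroup →
      ∀ v : List (Fin 3), v.length = n →
        SplitsIntoDistinctIrreducibles (quasiRegular (MulAction.stabilizer G v)) (2 * n + 1)
          ({1, 1, 1} + (Multiset.Ico 1 n).bind (fun i => {3 ^ i, 3 ^ i}))) := by
  constructor
  · rintro G hG v rfl
    obtain ⟨hG₁, hG₂⟩ : SelfReplicating G ∧ ∀ v w : List (Fin 2), v.length = w.length + 1 →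
        v.take w.length ≠ w → ∃ g ∈ G, g v = v ∧ RotatesAt g w := by
      rcases hG with rfl | rfl
      exacts [⟨isBinarySystem.selfReplicating, isBinarySystem.exists_fix_and_rotatesAt⟩,
        ⟨isBinarySystem_tilde.selfReplicating, isBinarySystem_tilde.exists_fix_and_rotatesAt⟩]
    have h := splitsIntoDistinctIrreducibles_quasiRegular Nat.prime_two hG₁ hG₂ hn
    rw [show 2 + (v.length - 1) * (2 - 1) = v.length + 1 by omega] at h
    simp only [Nat.add_one_sub_one, Multiset.replicate_one, Multiset.bind_singleton] at h
    exact h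
  · rintro G hG v rfl
    obtain ⟨l, rfl⟩ : ∃ l, G = spineGroup l := by
      rcases hG with rfl | rfl | rfl
      exacts [⟨0, rfl⟩, ⟨1, rfl⟩, ⟨-1, rfl⟩]
    have h := splitsIntoDistinctIrreducibles_quasiRegular Nat.prime_three
      (selfReplicating_spineGroup l) (exists_fix_and_rotatesAt_spineGroup l) hn
    rw [show 3 + (v.length - 1) * (3 - 1) = 2 * v.length + 1 by omega] at h
    exact h
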